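/- Let $H=\begin{pmatrix}0&0&1\\0&1&0\\1&0&0\end{pmatrix}$, let $\langle v,w\rangle=w^*Hv$ be the corresponding Hermitian form of signature $(2,1)$ on $\mathbb C^3$, let $\mathrm{SU}(2,1)=\{A\in \mathrm{SL}(3,\mathbb C): A^*HA=H\}$, and let $\mathrm{PU}(2,1)$ be the quotient of $\mathrm{SU}(2,1)$ by its centre. An element of $\mathrm{SU}(2,1)$ is elliptic if it fixes a point of the complex hyperbolic plane $\mathbf H^2_{\mathbb C}=\{[v]:\langle v,v\rangle<0\}$, and parabolic if it fixes no point of $\mathbf H^2_{\mathbb C}$ and exactly one point of $\partial\mathbf H^2_{\mathbb C}=\{[v]:v\neq 0,\ \langle v,v\rangle=0\}$. Write $[J_1,J_2]=J_1J_2J_1^{-1}J_2^{-1}$ and let $$\begin{aligned}P(X,Y)={}&Y^8+4(4X^2-14X+27)Y^6+6(12X^4-8X^3+360X^2-756X+729)Y^4\\&+4(16X^6-24X^5+1404X^4-4536X^3+20412X^2-30618X+19683)Y^2\\&+(2X^2-2X+27)(2X^2-18X+27)^3.\end{aligned}$$ **Theorem.** There is a one-parameter family of groups $\langle J_1,J_2\rangle$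 in $\mathrm{SU}(2,1)$ with $J_1,J_2$ elliptic of order $3$ and with $J_1J_2$, $J_1J_2^{-1}$ and $[J_1,J_2]$ all parabolic. More precisely, on the interval $I=\left[\frac{9-3\sqrt3}{2},\frac{9+3\sqrt3}{2}\right]$ there are continuous maps $X\mapsto J_1(X)$ and $X\mapsto J_2(X)$ into $\mathrm{SU}(2,1)$ and a continuous function $Y:I\to\mathbb R$ such that, for every $X\in I$, writing $J_i=J_i(X)$ and $Y=Y(X)$: 1. $J_1$ and $J_2$ are elliptic, and have order $3$ both in $\mathrm{SU}(2,1)$ and in $\mathrm{PU}(2,1)$; 2. $J_1J_2$, $J_1J_2^{-1}$ and $[J_1,J_2]$ are parabolic; 3. $P(X,Y)=0$, $\ |\mathrm{tr}(J_1J_2^{-1})|^2=X$, and $\ \mathrm{tr}[J_1,J_2]=\dfrac{2X^2-6X+27+Y^2+2iXY}{4X}$. Moreover, if $X\neq X'$ are in $I$, then no element of $\mathrm{PU}(2,1)$ simultaneously conjugates the images of $J_1(X),J_2(X)$ in $\mathrm{PU}(2,1)$ to those of $J_1(X'),J_2(X')$. -/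

import Mathlib

open Matrix

/-- The Hermitian matrix of signature `(2,1)` defining the Siegel model of the complex
hyperbolic plane. -/
def siegelForm : Matrix (Fin 3) (Fin 3) ℂ :=
  !![0, 0, 1; 0, 1, 0; 1, 0, 0]

/-- The Hermitian product `⟨v, w⟩ = w* H v`, linear in `v` and antilinear in `w`. -/
def herm (v w : Fin 3 → ℂ) : ℂ := star w ⬝ᵥ (siegelForm *ᵥ v)

/-- The group `SU(2,1)` of complex `3 × 3` matrices of determinant one that preserve the
Hermitian form `herm`. -/
def SU21 : Subgroup (Matrix.SpecialLinearGroup (Fin 3) ℂ) where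
  carrier := {A | (A : Matrix (Fin 3) (Fin 3) ℂ)ᴴ * siegelForm
    * (A : Matrix (Fin 3) (Fin 3) ℂ) = siegelForm}
  one_mem' := by simp
  mul_mem' := by
    intro A B hA hB
    simp only [Set.mem_ofPred_eq] at hA hB ⊢
    rw [Matrix.SpecialLinearGroup.coe_mul, Matrix.conjTranspose_mul]
    calc _ = (B : Matrix (Fin 3) (Fin 3) ℂ)ᴴ * ((A : Matrix (Fin 3) (Fin 3) ℂ)ᴴ * siegelForm
          * (A : Matrix (Fin 3) (Fin 3) ℂ)) * (B : Matrix (Fin 3) (Fin 3) ℂ) := by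
            simp only [Matrix.mul_assoc]
      _ = siegelForm := by rw [hA, hB]
  inv_mem' := by
    intro A hA
    simp only [Set.mem_ofPred_eq] at hA ⊢
    have h1 : (A : Matrix (Fin 3) (Fin 3) ℂ)
        * ((A⁻¹ : Matrix.SpecialLinearGroup (Fin 3) ℂ) : Matrix (Fin 3) (Fin 3) ℂ) = 1 := by
      rw [← Matrix.SpecialLinearGroup.coe_mul, mul_inv_cancel,
        Matrix.SpecialLinearGroup.coe_one]
    have h2 : ((A⁻¹ : Matrix.SpecialLinearGroup (Fin 3) ℂ) : Matrix (Fin 3) (Fin 3) ℂ)ᴴ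
        * (A : Matrix (Fin 3) (Fin 3) ℂ)ᴴ = 1 := by
      rw [← Matrix.conjTranspose_mul, h1, Matrix.conjTranspose_one]
    generalize ((A⁻¹ : Matrix.SpecialLinearGroup (Fin 3) ℂ) : Matrix (Fin 3) (Fin 3) ℂ) = B
      at h1 h2 ⊢
    calc Bᴴ * siegelForm * B = (Bᴴ * (A : Matrix (Fin 3) (Fin 3) ℂ)ᴴ) * siegelForm
          * ((A : Matrix (Fin 3) (Fin 3) ℂ) * B) := by
            conv_lhs => rw [← hA]
            simp only [Matrix.mul_assoc]
      _ = siegelForm := by rw [h1, h2, Matrix.one_mul, Matrix.mul_one]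

/-- The underlying matrix of an element of `SU(2,1)`. -/
def toMat (A : SU21) : Matrix (Fin 3) (Fin 3) ℂ := (A.1 : Matrix (Fin 3) (Fin 3) ℂ)

/-- The group `PU(2,1)` of holomorphic isometries of the complex hyperbolic plane, as the
quotient of `SU(2,1)` by its centre (the scalar matrices in it). -/
abbrev PU21 : Type := SU21 ⧸ Subgroup.center SU21

/-- The isometry defined by an element of `SU(2,1)`. -/
def toPU (A : SU21) : PU21 := QuotientGroup.mk A

/-- `v` is an eigenvector of `A`, that is, `A` fixes the point `[v]` of the projective plane. -/
def FixesPoint (A : SU21) (v : Fin 3 → ℂ) : Prop :=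
  v ≠ 0 ∧ ∃ μ : ℂ, toMat A *ᵥ v = μ • v

/-- `A` is elliptic: it fixes a point of the complex hyperbolic plane, whose points are
the complex lines spanned by vectors `v` with `⟨v, v⟩ < 0`. -/
def IsEllipticSU (A : SU21) : Prop :=
  ∃ v : Fin 3 → ℂ, (herm v v).re < 0 ∧ FixesPoint A v

/-- `A` is parabolic: it fixes no point of the complex hyperbolic plane and exactly one
point of its boundary, whose points are the complex lines spanned by non-zero vectors `v`
with `⟨v, v⟩ = 0`. -/
def IsParabolicSU (A : SU21) : Prop :=
  ¬ IsEllipticSU A ∧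
    ∃ v : Fin 3 → ℂ, herm v v = 0 ∧ FixesPoint A v ∧
      ∀ w : Fin 3 → ℂ, herm w w = 0 → FixesPoint A w → ∃ c : ℂ, w = c • v

/-- The polynomial whose zero locus describes the family. -/
def pinchPoly (X Y : ℝ) : ℝ :=
  Y ^ 8 + 4 * (4 * X ^ 2 - 14 * X + 27) * Y ^ 6
    + 6 * (12 * X ^ 4 - 8 * X ^ 3 + 360 * X ^ 2 - 756 * X + 729) * Y ^ 4
    + 4 * (16 * X ^ 6 - 24 * X ^ 5 + 1404 * X ^ 4 - 4536 * X ^ 3 + 20412 * X ^ 2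
        - 30618 * X + 19683) * Y ^ 2
    + (2 * X ^ 2 - 2 * X + 27) * (2 * X ^ 2 - 18 * X + 27) ^ 3

/-- The parameter interval. -/
def pinchInterval : Set ℝ :=
  Set.Icc ((9 - 3 * Real.sqrt 3) / 2) ((9 + 3 * Real.sqrt 3) / 2)

/-! The characteristic polynomial of an element of `SU21` depends only on its trace. It has a double
root of modulus one exactly when the trace lies on the deltoid, the curve of values `2l + star l ^
2` with `|l| = 1`. A deltoid trace gives a parabolic element unless the element is diagonalisable,
hence scalar or a complex reflection. For a product `A B` of trace-zero elements with `B ^ 3 = 1` a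
reflection is impossible: its polar vector `n` would make `n, Bn, B²n` mutually orthogonal of equal
nonzero norm, against signature (2,1) (`not_reflection_of_trace_zero`,
`isParabolicSU_mul_of_trace_zero`). The commutator is itself such a product, of `A` and `B A⁻¹ B⁻¹`.
So the theorem reduces to putting three traces on the deltoid.

Order-three elements are taken in the form `cubicMat h t`, with `h = k m` for `J₁` and `h = k * star
m` for `J₂`. Then `tr(J₁J₂⁻¹) = 2m² + star (m²)²` is on the deltoid automatically, and `X` fixes
`m`. Writing `tr(J₁J₂) = -(star k) r`, the deltoid condition fixes the real part of `k³` in terms of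
`r`. The commutator has trace `(X + r² - 3)/2 + iY/2`; compatibility of the two normal forms amounts
to `2Xr² = 27 + Y²`, and the third deltoid condition then becomes `pinchPoly X Y = 0`
(`family_properties`).

As a quartic in `Y²`, `pinchPoly` is strictly increasing on the nonnegative axis, and its constant
term is nonpositive on the interval. Its unique nonnegative root is therefore continuous in `X`, and
so is everything built from it. Members of the family are told apart by `|tr(J₁J₂⁻¹)|² = X`. -/

/-! ### The Hermitian form and the group preserving it. -/

theorem herm_eq (v w : Fin 3 → ℂ) :
    herm v w = star (w 0) * v 2 + star (w 1) * v 1 + star (w 2) * v 0 := by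
  simp [herm, siegelForm, Matrix.mulVec, dotProduct, Fin.sum_univ_three]

theorem herm_add_left (u v w : Fin 3 → ℂ) : herm (u + v) w = herm u w + herm v w := by
  simp only [herm_eq, Pi.add_apply]; ring

theorem herm_add_right (u v w : Fin 3 → ℂ) : herm u (v + w) = herm u v + herm u w := by
  simp only [herm_eq, Pi.add_apply, star_add]; ring

theorem herm_smul_left (c : ℂ) (v w : Fin 3 → ℂ) : herm (c • v) w = c * herm v w := by
  simp only [herm_eq, Pi.smul_apply, smul_eq_mul]; ring

theorem herm_smul_right (c : ℂ) (v w : Fin 3 → ℂ) : herm v (c • w) = star c * herm v w := by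
  simp only [herm_eq, Pi.smul_apply, smul_eq_mul, star_mul']; ring

theorem star_herm (v w : Fin 3 → ℂ) : star (herm v w) = herm w v := by
  simp only [herm_eq, star_add, star_mul', star_star]; ring

theorem siegelForm_mul_self : siegelForm * siegelForm = 1 := by
  ext i j
  fin_cases i <;> fin_cases j <;> simp [siegelForm, Matrix.mul_apply, Fin.sum_univ_three]

theorem det_siegelForm : siegelForm.det = -1 := by
  simp [siegelForm, Matrix.det_fin_three]

theorem toMat_mul (A B : SU21) : toMat (A * B) = toMat A * toMat B := rfl

theorem toMat_one : toMat 1 = 1 := rfl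

theorem toMat_injective : Function.Injective toMat := fun _ _ h =>
  Subtype.ext (Subtype.ext h)

theorem det_toMat (A : SU21) : (toMat A).det = 1 := A.1.2

theorem toMat_form (A : SU21) : (toMat A)ᴴ * siegelForm * toMat A = siegelForm := A.2

theorem toMat_mul_inv (A : SU21) : toMat A * toMat A⁻¹ = 1 := by
  rw [← toMat_mul, mul_inv_cancel, toMat_one]

theorem toMat_inv (A : SU21) : toMat A⁻¹ = siegelForm * (toMat A)ᴴ * siegelForm := by
  have h : siegelForm * (toMat A)ᴴ * siegelForm * toMat A = 1 := by
    rw [Matrix.mul_assoc, Matrix.mul_assoc, ← Matrix.mul_assoc (toMat A)ᴴ, toMat_form,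
      siegelForm_mul_self]
  exact (left_inv_eq_right_inv h (toMat_mul_inv A)).symm

theorem trace_toMat_inv (A : SU21) : (toMat A⁻¹).trace = star (toMat A).trace := by
  rw [toMat_inv, Matrix.trace_mul_comm, ← Matrix.mul_assoc, siegelForm_mul_self, Matrix.one_mul,
    Matrix.trace_conjTranspose]

theorem trace_toMat_conj (A B : SU21) : (toMat (A * B * A⁻¹)).trace = (toMat B).trace := by
  rw [toMat_mul, Matrix.trace_mul_comm, ← toMat_mul]
  simp

theorem herm_toMat (A : SU21) (v w : Fin 3 → ℂ) :
    herm (toMat A *ᵥ v) (toMat A *ᵥ w) = herm v w := by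
  simp only [herm]
  rw [Matrix.star_mulVec, Matrix.dotProduct_mulVec, Matrix.vecMul_vecMul,
    ← Matrix.dotProduct_mulVec, Matrix.mulVec_mulVec, toMat_form]

/-- In the orthogonal complement of a null vector the form is nonnegative, and vanishes only on
multiples of the null vector. -/
theorem herm_orthogonal_null {v w : Fin 3 → ℂ} (hv : v ≠ 0) (hvv : herm v v = 0)
    (hwv : herm w v = 0) : 0 ≤ (herm w w).re ∧ (herm w w = 0 → ∃ c : ℂ, w = c • v) := by
  rw [herm_eq] at hvv hwv ⊢
  by_cases h2 : v 2 = 0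
  · have h1 : v 1 = 0 := by simpa [h2] using hvv
    have h0 : v 0 ≠ 0 := by
      intro h0
      apply hv
      ext i
      fin_cases i <;> simp [h0, h1, h2]
    have w2 : w 2 = 0 := by simpa [h1, h2, h0] using hwv
    simp only [w2, star_zero, mul_zero, zero_mul, zero_add, add_zero]
    constructor
    · simp only [Complex.star_def, Complex.mul_re, Complex.conj_re, Complex.conj_im]
      nlinarith [sq_nonneg (w 1).re, sq_nonneg (w 1).im]
    · intro hw
      have w1 : w 1 = 0 := by simpa using hw
      refine ⟨w 0 / v 0, ?_⟩
      ext i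
      fin_cases i <;> simp [h0, w1, h1, h2, w2]
  · have h2' : star (v 2) ≠ 0 := by simpa using h2
    set c := w 2 / v 2 with hc
    have hw2 : w 2 = c * v 2 := by rw [hc]; field_simp
    -- `w - c v` has last coordinate zero, so its norm is `|d|²`; this is also the norm of `w`,
    -- because `v` is null and orthogonal to `w`.
    obtain ⟨d, hd⟩ : ∃ d, w 1 = c * v 1 + d := ⟨w 1 - c * v 1, by ring⟩
    have hw0 : star (v 2) * w 0 = star (v 2) * (c * v 0) - star (v 1) * d := by
      rw [hw2, hd] at hwv
      linear_combination hwv - c * hvv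
    have hw0' := congrArg star hw0
    simp only [star_mul', star_sub, star_star] at hw0'
    have key : star (w 0) * w 2 + star (w 1) * w 1 + star (w 2) * w 0 = star d * d := by
      rw [hw2, hd]
      simp only [star_mul', star_add]
      linear_combination c * hw0' + star c * hw0 + star c * c * hvv
    rw [key]
    constructor
    · simp only [Complex.star_def, Complex.mul_re, Complex.conj_re, Complex.conj_im]
      nlinarith [sq_nonneg d.re, sq_nonneg d.im]
    · intro hw
      have d0 : d = 0 := by simpa using hw
      rw [d0, mul_zero, sub_zero] at hw0
      have := mul_left_cancel₀ h2' hw0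
      refine ⟨c, ?_⟩
      ext i
      fin_cases i <;> simp [this, hd, hw2, d0]

/-! ### Parabolicity from the trace. -/

/-- An element with a nontrivial Jordan block at an eigenvalue of modulus one is parabolic. -/
theorem isParabolicSU_of_jordan (A : SU21) {l : ℂ} (hl : l * star l = 1) {v y : Fin 3 → ℂ}
    (hv : v ≠ 0) (hAv : toMat A *ᵥ v = l • v) (hAy : toMat A *ᵥ y = l • y + v) :
    IsParabolicSU A := by
  have l0 : star l ≠ 0 := right_ne_zero_of_mul_eq_one hl
  -- Invariance of `⟨y, w⟩` under `A` leaves the term `⟨v, w⟩` alone. Taking `w = v` also shows that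
  -- `v` is null.
  have orth_same : ∀ w, toMat A *ᵥ w = l • w → herm v w = 0 := by
    intro w hw
    have h := herm_toMat A y w
    rw [hAy, hw, herm_smul_right, herm_add_left, herm_smul_left] at h
    have : star l * herm v w = 0 := by linear_combination h - herm y w * hl
    exact (mul_eq_zero.1 this).resolve_left l0
  -- An eigenvalue `n` with `⟨w, v⟩ ≠ 0` satisfies `n * star l = 1`, so `n = l` and the previous
  -- step applies. All fixed points thus lie in the complement of `v`.
  have orth : ∀ w, FixesPoint A w → herm w v = 0 := by
    rintro w ⟨-, n, hw⟩
    by_contra hne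
    have h := herm_toMat A w v
    rw [hw, hAv, herm_smul_left, herm_smul_right] at h
    have h1 : n * star l = 1 := by
      apply mul_right_cancel₀ hne
      linear_combination h
    have hn : n = l := by
      apply mul_right_cancel₀ l0
      rw [h1, hl]
    rw [hn] at hw
    apply hne
    rw [← star_herm, orth_same w hw, star_zero]
  have hvv := orth_same v hAv
  refine ⟨?_, v, hvv, ⟨hv, l, hAv⟩, ?_⟩
  · rintro ⟨w, hneg, hw⟩
    exact absurd (herm_orthogonal_null hv hvv (orth w hw)).1 (not_le.2 hneg)
  · intro w hww hw
    exact (herm_orthogonal_null hv hvv (orth w hw)).2 hww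

theorem cayley_hamilton_fin_three {R : Type*} [CommRing R] (M : Matrix (Fin 3) (Fin 3) R) :
    M * M * M - M.trace • (M * M) + M.adjugate.trace • M - M.det • (1 : Matrix _ _ R) = 0 := by
  ext i j
  simp only [Matrix.adjugate_fin_three, Matrix.trace_fin_three, Matrix.det_fin_three]
  fin_cases i <;> fin_cases j <;>
    simp [Matrix.mul_apply, Fin.sum_univ_three] <;> ring

/-- The adjugate is `A⁻¹ = H A* H`, whose trace is conjugate to that of `A`; the trace alone
determines the characteristic polynomial. -/
theorem cayley_hamilton_toMat (A : SU21) :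
    toMat A * toMat A * toMat A - (toMat A).trace • (toMat A * toMat A)
      + star (toMat A).trace • toMat A - 1 = 0 := by
  have h := cayley_hamilton_fin_three (toMat A)
  have h2 : (toMat A).adjugate = toMat A⁻¹ := by
    rw [toMat, toMat, Subgroup.coe_inv, Matrix.SpecialLinearGroup.coe_inv]
  rwa [h2, det_toMat, one_smul, trace_toMat_inv] at h

theorem eq_zero_of_herm_eq_zero {n : Fin 3 → ℂ} (h : ∀ y, herm n y = 0) : n = 0 := by
  have h0 := h ![1, 0, 0]
  have h1 := h ![0, 1, 0]
  have h2 := h ![0, 0, 1]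
  simp [herm_eq] at h0 h1 h2
  ext i
  fin_cases i <;> simp [h0, h1, h2]

/-- In signature `(2,1)` there are no three mutually orthogonal vectors of the same nonzero norm. -/
theorem no_orthogonal_triple {a b c : Fin 3 → ℂ} {r : ℂ} (hr : r ≠ 0) (haa : herm a a = r)
    (hbb : herm b b = r) (hcc : herm c c = r) (hab : herm a b = 0) (hac : herm a c = 0)
    (hbc : herm b c = 0) : False := by
  have hba : herm b a = 0 := by rw [← star_herm, hab, star_zero]
  have hca : herm c a = 0 := by rw [← star_herm, hac, star_zero]
  have hcb : herm c b = 0 := by rw [← star_herm, hbc, star_zero]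
  have hrr : star r = r := by rw [← haa, star_herm]
  set S : Matrix (Fin 3) (Fin 3) ℂ := (Matrix.of ![a, b, c])ᵀ with hS
  have hG : Sᴴ * siegelForm * S = r • 1 := by
    have e : ∀ i j, (Sᴴ * siegelForm * S) i j = herm (![a, b, c] j) (![a, b, c] i) := by
      intro i j
      fin_cases i <;> fin_cases j <;>
        simp [herm_eq, hS, siegelForm, Matrix.mul_apply, Fin.sum_univ_three] <;> ring
    ext i j
    rw [e]
    fin_cases i <;> fin_cases j <;> simp [*]
  have hdet := congrArg Matrix.det hG
  rw [Matrix.det_mul, Matrix.det_mul, det_siegelForm, Matrix.det_conjTranspose,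
    Matrix.det_smul, Matrix.det_one, Fintype.card_fin, mul_one] at hdet
  have hSdet : S.det ≠ 0 := by
    intro h
    rw [h] at hdet
    simp only [mul_zero] at hdet
    exact pow_ne_zero 3 hr hdet.symm
  obtain ⟨ρ, rfl⟩ : ∃ ρ : ℝ, r = ρ := ⟨r.re, (Complex.conj_eq_iff_re.1 hrr).symm⟩
  -- The vector `(0, 1, 0)` has norm 1; expanding it in the basis `a, b, c` forces `ρ > 0`, whereas
  -- the Gram determinant gives `ρ³ = -|det S|²`.
  set x := S⁻¹ *ᵥ ![0, 1, 0] with hx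
  have hSx : S *ᵥ x = ![0, 1, 0] := by
    rw [hx, Matrix.mulVec_mulVec, Matrix.mul_nonsing_inv _ (isUnit_iff_ne_zero.2 hSdet),
      Matrix.one_mulVec]
  have h1 : herm (S *ᵥ x) (S *ᵥ x) = 1 := by rw [hSx]; simp [herm_eq]
  have h2 : herm (S *ᵥ x) (S *ᵥ x) = ρ * (star x ⬝ᵥ x) := by
    simp only [herm]
    rw [Matrix.star_mulVec, Matrix.dotProduct_mulVec, Matrix.vecMul_vecMul,
      ← Matrix.dotProduct_mulVec, Matrix.mulVec_mulVec, hG, Matrix.smul_mulVec,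
      Matrix.one_mulVec, dotProduct_smul, smul_eq_mul]
  rw [h1] at h2
  have h3 : (star x ⬝ᵥ x) = ((∑ i, Complex.normSq (x i) : ℝ) : ℂ) := by
    simp [dotProduct, Complex.normSq_eq_conj_mul_self]
  rw [h3] at h2
  have h4 : 1 = ρ * ∑ i, Complex.normSq (x i) := by exact_mod_cast h2
  have h5 : 0 ≤ ∑ i, Complex.normSq (x i) := Finset.sum_nonneg fun i _ => Complex.normSq_nonneg _
  have hρ : 0 < ρ := by
    by_contra hneg
    nlinarith
  have h6 : -Complex.normSq S.det = ρ ^ 3 := by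
    have : ((-Complex.normSq S.det : ℝ) : ℂ) = ((ρ ^ 3 : ℝ) : ℂ) := by
      push_cast
      rw [Complex.normSq_eq_conj_mul_self, ← hdet]
      simp
    exact_mod_cast this
  nlinarith [Complex.normSq_nonneg S.det, pow_pos hρ 3]

/-- An idempotent matrix of trace one has its image spanned by a vector. -/
theorem exists_span_of_idempotent {P : Matrix (Fin 3) (Fin 3) ℂ} (hP : P * P = P)
    (htr : P.trace = 1) : ∃ n : Fin 3 → ℂ, n ≠ 0 ∧ P *ᵥ n = n ∧ ∀ x, ∃ c : ℂ, P *ᵥ x = c • n := by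
  have hid : IsIdempotentElem (Matrix.toLin' P) := by
    rw [IsIdempotentElem, Module.End.mul_eq_comp, ← Matrix.toLin'_mul, hP]
  have h := LinearMap.IsIdempotentElem.isProj_range _ hid
  have ht := LinearMap.IsProj.trace h
  rw [Matrix.trace_toLin'_eq, htr] at ht
  have h1 : Module.finrank ℂ (LinearMap.range (Matrix.toLin' P)) = 1 := by exact_mod_cast ht.symm
  obtain ⟨⟨n, hn⟩, hn0, hspan⟩ := finrank_eq_one_iff'.1 h1
  refine ⟨n, by simpa using hn0, ?_, fun x => ?_⟩
  · obtain ⟨z, rfl⟩ := hn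
    rw [Matrix.toLin'_apply, Matrix.mulVec_mulVec, hP]
  · obtain ⟨c, hc⟩ := hspan ⟨P *ᵥ x, ⟨x, by simp⟩⟩
    exact ⟨c, (congrArg Subtype.val hc).symm⟩

/-- The product of two elements of trace zero, one of them of order three, is not a complex
reflection. -/
theorem not_reflection_of_trace_zero {A B : SU21} (hA : (toMat A).trace = 0)
    (hB : (toMat B).trace = 0) (hB3 : toMat B * toMat B * toMat B = 1) {l : ℂ}
    (hl : l * star l = 1) (hl3 : l ^ 3 ≠ 1)
    (htr : (toMat (A * B)).trace = 2 * l + star l ^ 2)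
    (hM : (toMat (A * B) - l • 1) * (toMat (A * B) - star l ^ 2 • 1) = 0) : False := by
  have l0 : l ≠ 0 := left_ne_zero_of_mul_eq_one hl
  set M := toMat (A * B) with hMdef
  set d := star l ^ 2 - l with hd
  have hd0 : d ≠ 0 := by
    intro h
    apply hl3
    have h' : star l ^ 2 = l := by rw [hd] at h; linear_combination h
    linear_combination (-(l ^ 2)) * h' + (l * star l + 1) * hl
  have hsl3 : star l ^ 3 ≠ 1 := by
    intro h
    apply hl3
    have := congrArg star h
    simpa using this
  -- Since `l³ ≠ 1` the two eigenvalues differ, and `P` is the spectral projection for the simple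
  -- one. It is the orthogonal projection onto the line of `n`.
  set P : Matrix (Fin 3) (Fin 3) ℂ := d⁻¹ • (M - l • 1) with hP
  have hMP : M = l • 1 + d • P := by
    rw [hP, smul_smul, mul_inv_cancel₀ hd0, one_smul]; abel
  have hEE : (M - l • 1) * (M - l • 1) = d • (M - l • 1) := by
    have : M - l • 1 = (M - star l ^ 2 • 1) + d • (1 : Matrix _ _ ℂ) := by
      rw [hd, sub_smul]; abel
    conv_lhs => rw [this, Matrix.add_mul, ← this]
    have hc : (M - star l ^ 2 • 1) * (M - l • 1) = (M - l • 1) * (M - star l ^ 2 • 1) := by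
      simp only [Matrix.sub_mul, Matrix.mul_sub, Matrix.smul_mul, Matrix.mul_smul,
        Matrix.one_mul, Matrix.mul_one, smul_sub, smul_smul, mul_comm l]
      abel
    rw [hc, hM, zero_add, Matrix.smul_mul, Matrix.one_mul]
  have hPP : P * P = P := by
    rw [hP, Matrix.smul_mul, Matrix.mul_smul, hEE, smul_smul, smul_smul, mul_assoc,
      inv_mul_cancel₀ hd0, mul_one]
  have hPtr : P.trace = 1 := by
    rw [hP, Matrix.trace_smul, Matrix.trace_sub, Matrix.trace_smul, Matrix.trace_one, htr,
      smul_eq_mul, smul_eq_mul, Fintype.card_fin]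
    rw [inv_mul_eq_one₀ hd0, hd]
    push_cast
    ring
  obtain ⟨n, hn0, hPn, hspan⟩ := exists_span_of_idempotent hPP hPtr
  have hMPx : ∀ x, M *ᵥ (P *ᵥ x) = star l ^ 2 • (P *ᵥ x) := by
    intro x
    have : M * P = star l ^ 2 • P := by
      conv_lhs => rw [hMP]
      rw [Matrix.add_mul, Matrix.smul_mul, Matrix.smul_mul, hPP, Matrix.one_mul, ← add_smul, hd]
      congr 1
      ring
    rw [Matrix.mulVec_mulVec, this, Matrix.smul_mulVec]
  have hMQ : ∀ x, M *ᵥ (x - P *ᵥ x) = l • (x - P *ᵥ x) := by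
    intro x
    have : M * (1 - P) = l • (1 - P) := by
      conv_lhs => rw [hMP]
      rw [Matrix.add_mul, Matrix.smul_mul, Matrix.smul_mul, Matrix.mul_sub P, hPP, Matrix.one_mul,
        Matrix.mul_one, sub_self, smul_zero, add_zero]
    have h2 : x - P *ᵥ x = (1 - P) *ᵥ x := by rw [Matrix.sub_mulVec, Matrix.one_mulVec]
    rw [h2, Matrix.mulVec_mulVec, this, Matrix.smul_mulVec]
  have horth : ∀ x y, herm (P *ᵥ x) (y - P *ᵥ y) = 0 := by
    intro x y
    have h := herm_toMat (A * B) (P *ᵥ x) (y - P *ᵥ y)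
    rw [← hMdef, hMPx, hMQ, herm_smul_left, herm_smul_right] at h
    have h2 : (star l ^ 3 - 1) * herm (P *ᵥ x) (y - P *ᵥ y) = 0 := by linear_combination h
    exact (mul_eq_zero.1 h2).resolve_left (sub_ne_zero.2 hsl3)
  have hself : ∀ x y, herm (P *ᵥ x) y = herm (P *ᵥ x) (P *ᵥ y) := by
    intro x y
    have h := horth x y
    rw [sub_eq_add_neg, herm_add_right, ← neg_one_smul ℂ, herm_smul_right] at h
    simp only [star_neg, star_one] at h
    linear_combination h
  set r := herm n n with hr
  have hr0 : r ≠ 0 := by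
    intro h
    apply hn0
    apply eq_zero_of_herm_eq_zero
    intro y
    obtain ⟨c, hc⟩ := hspan y
    have := hself n y
    rw [hPn, hc, herm_smul_right, ← hr, h, mul_zero] at this
    exact this
  have hPy : ∀ y, P *ᵥ y = (herm y n / r) • n := by
    intro y
    obtain ⟨c, hc⟩ := hspan y
    have h := hself n y
    rw [hPn, hc, herm_smul_right, ← hr] at h
    have h2 := congrArg star h
    rw [star_herm, star_mul', star_star, hr, star_herm, ← hr] at h2
    rw [hc, h2, mul_div_cancel_right₀ _ hr0]
  -- `P` is `x ↦ (⟨x, n⟩ / r) n`, so `tr(PK) = ⟨Kn, n⟩ / r`.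
  have hPtrK : ∀ K : Matrix (Fin 3) (Fin 3) ℂ, (P * K).trace = 0 → herm (K *ᵥ n) n = 0 := by
    intro K hK
    have hPv : P = r⁻¹ • Matrix.vecMulVec n (star n ᵥ* siegelForm) := by
      apply Matrix.toLin'.injective
      ext1 j
      ext i
      simp only [LinearMap.comp_apply, Matrix.toLin'_apply, hPy, Matrix.smul_mulVec,
        Matrix.vecMulVec_mulVec, herm, Matrix.dotProduct_mulVec, Pi.smul_apply, smul_eq_mul,
        MulOpposite.smul_eq_mul_unop, MulOpposite.unop_op]
      ring
    rw [hPv, Matrix.smul_mul, Matrix.vecMulVec_mul, Matrix.trace_smul, Matrix.trace_vecMulVec,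
      smul_eq_mul] at hK
    have h2 := (mul_eq_zero.1 hK).resolve_left (inv_ne_zero hr0)
    rw [herm, Matrix.dotProduct_mulVec, Matrix.dotProduct_mulVec, dotProduct_comm]
    exact h2
  -- Take traces in `A = M B⁻¹ = l B⁻¹ + d P B⁻¹`: both `A` and `B⁻¹` have trace zero.
  have hinv : herm (toMat B⁻¹ *ᵥ n) n = 0 := by
    apply hPtrK
    have h1 : toMat A = toMat (A * B) * toMat B⁻¹ := by
      rw [← toMat_mul, mul_inv_cancel_right]
    rw [← hMdef, hMP, Matrix.add_mul, Matrix.smul_mul, Matrix.one_mul, Matrix.smul_mul] at h1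
    have h2 := congrArg Matrix.trace h1
    rw [hA, Matrix.trace_add, Matrix.trace_smul, Matrix.trace_smul, trace_toMat_inv, hB,
      star_zero, smul_zero, zero_add, smul_eq_mul] at h2
    exact (mul_eq_zero.1 h2.symm).resolve_left hd0
  have h1 : herm n (toMat B *ᵥ n) = 0 := by
    rw [← herm_toMat B, Matrix.mulVec_mulVec, toMat_mul_inv, Matrix.one_mulVec] at hinv
    exact hinv
  have h3 : toMat B *ᵥ (toMat B *ᵥ (toMat B *ᵥ n)) = n := by
    rw [Matrix.mulVec_mulVec, Matrix.mulVec_mulVec, hB3, Matrix.one_mulVec]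
  refine no_orthogonal_triple hr0 (a := n) (b := toMat B *ᵥ n)
    (c := toMat B *ᵥ (toMat B *ᵥ n)) rfl (herm_toMat _ _ _) ?_ h1 ?_ ?_
  · rw [herm_toMat, herm_toMat]
  · rw [← herm_toMat B, h3, ← star_herm, h1, star_zero]
  · rw [herm_toMat, h1]

/-- The product of two elements of trace zero, one of them of order three, is parabolic when its
trace lies on the deltoid and it is not scalar. -/
theorem isParabolicSU_mul_of_trace_zero {A B : SU21} (hA : (toMat A).trace = 0)
    (hB : (toMat B).trace = 0) (hB3 : toMat B * toMat B * toMat B = 1) {l : ℂ}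
    (hl : l * star l = 1) (htr : (toMat (A * B)).trace = 2 * l + star l ^ 2)
    (hne : toMat (A * B) ≠ l • 1) : IsParabolicSU (A * B) := by
  set M := toMat (A * B) with hMdef
  have exv : ∀ N : Matrix (Fin 3) (Fin 3) ℂ, N ≠ 0 → ∃ x, N *ᵥ x ≠ 0 := by
    intro N hN
    by_contra! h
    apply hN
    apply Matrix.toLin'.injective
    ext1 j
    ext i
    simp [h]
  have hch := cayley_hamilton_toMat (A * B)
  rw [← hMdef, htr] at hch
  have hch2 : (M - l • 1) * ((M - l • 1) * (M - star l ^ 2 • 1)) = 0 := by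
    rw [← hch]
    have e1 : star (2 * l + star l ^ 2) = l * l + 2 * (l * star l ^ 2) := by
      simp only [star_add, star_mul', star_pow, star_star, star_ofNat]
      linear_combination (-2 * star l) * hl
    have e2 : star l ^ 2 * l * l = 1 := by linear_combination (l * star l + 1) * hl
    rw [e1]
    simp only [Matrix.sub_mul, Matrix.mul_sub, Matrix.smul_mul, Matrix.mul_smul,
      Matrix.one_mul, Matrix.mul_one, smul_sub, smul_smul, add_smul, two_mul, Matrix.mul_assoc,
      mul_comm l (star l ^ 2), e2, one_smul]
    abel
  -- The characteristic polynomial is `(x - l)² (x - star l ²)`. If the product of distinct-looking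
  -- factors is nonzero, there is a Jordan block at `l`. If it vanishes, either the factors coincide
  -- and a nonscalar `M` still has a block, or `M` is a reflection.
  by_cases hN : (M - l • 1) * (M - star l ^ 2 • 1) = 0
  · by_cases hl3 : l ^ 3 = 1
    · have hsl : star l ^ 2 = l := by
        linear_combination (-star l ^ 2) * hl3 + l * (l * star l + 1) * hl
      rw [hsl] at hN
      obtain ⟨x, hx⟩ := exv _ (sub_ne_zero.2 hne)
      refine isParabolicSU_of_jordan _ hl (v := (M - l • 1) *ᵥ x) (y := x) hx ?_ ?_
      · rw [← sub_eq_zero]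
        have := congrArg (· *ᵥ x) hN
        rw [← Matrix.mulVec_mulVec, Matrix.sub_mulVec, Matrix.smul_mulVec, Matrix.one_mulVec,
          Matrix.zero_mulVec] at this
        exact this
      · rw [Matrix.sub_mulVec, Matrix.smul_mulVec, Matrix.one_mulVec]; abel
    · exact (not_reflection_of_trace_zero hA hB hB3 hl hl3 htr hN).elim
  · obtain ⟨x, hx⟩ := exv _ hN
    rw [← Matrix.mulVec_mulVec] at hx
    refine isParabolicSU_of_jordan _ hl (v := (M - l • 1) *ᵥ ((M - star l ^ 2 • 1) *ᵥ x))
      (y := (M - star l ^ 2 • 1) *ᵥ x) hx ?_ ?_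
    · rw [← sub_eq_zero]
      have := congrArg (· *ᵥ x) hch2
      simp only [← Matrix.mulVec_mulVec, Matrix.zero_mulVec] at this
      rw [← this]
      conv_rhs => rw [Matrix.sub_mulVec, Matrix.smul_mulVec, Matrix.one_mulVec]
    · generalize (M - star l ^ 2 • 1) *ᵥ x = y
      rw [Matrix.sub_mulVec, Matrix.smul_mulVec, Matrix.one_mulVec]
      abel

/-! ### Elements of order three are elliptic. -/

theorem exists_primitive_cube_root : ∃ w : ℂ, w ^ 2 + w + 1 = 0 ∧ star w = w ^ 2 := by
  have h3 : Complex.I * Complex.I = -1 := Complex.I_mul_I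
  have hs : ((Real.sqrt 3 : ℝ) : ℂ) * ((Real.sqrt 3 : ℝ) : ℂ) = 3 := by
    rw [← Complex.ofReal_mul, Real.mul_self_sqrt (by norm_num)]; norm_num
  refine ⟨-1 / 2 + Real.sqrt 3 / 2 * Complex.I, ?_, ?_⟩
  · linear_combination (1 / 4 * Complex.I * Complex.I) * hs + 3 / 4 * h3
  · simp only [Complex.star_def, map_add, map_mul, map_div₀, map_neg, map_one, Complex.conj_I,
      Complex.conj_ofReal, map_ofNat]
    linear_combination (-1 / 4 * Complex.I * Complex.I) * hs - 3 / 4 * h3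

/-- An element whose cube is the identity is elliptic. -/
theorem isEllipticSU_of_cube {A : SU21} (h3 : toMat A * toMat A * toMat A = 1) :
    IsEllipticSU A := by
  obtain ⟨w, hw, hws⟩ := exists_primitive_cube_root
  have hw3 : w ^ 3 = 1 := by linear_combination (w - 1) * hw
  set v : Fin 3 → ℂ := ![1, 0, -1] with hv
  have hvv : herm v v = -2 := by simp [herm_eq, hv]; norm_num
  set v1 := toMat A *ᵥ v with hv1
  set v2 := toMat A *ᵥ v1 with hv2
  have hv3 : toMat A *ᵥ v2 = v := by
    rw [hv2, hv1, Matrix.mulVec_mulVec, Matrix.mulVec_mulVec, h3, Matrix.one_mulVec]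
  have h11 : herm v1 v1 = -2 := by rw [hv1, herm_toMat, hvv]
  have h22 : herm v2 v2 = -2 := by rw [hv2, herm_toMat, h11]
  have h21 : herm v2 v1 = herm v1 v := by rw [hv2]; conv_lhs => rw [hv1, herm_toMat]
  have h12 : herm v1 v2 = herm v v1 := by rw [← star_herm, h21, star_herm]
  have h20 : herm v2 v = herm v v1 := by rw [← herm_toMat A, hv3]
  have h02 : herm v v2 = herm v1 v := by rw [← star_herm, h20, star_herm]
  set q := herm v1 v
  set q' := herm v v1
  have hu : ∀ s : ℂ, s ^ 3 = 1 → star s = s ^ 2 →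
      herm (v + (s • v1 + s ^ 2 • v2)) (v + (s • v1 + s ^ 2 • v2))
        = -6 + 3 * (s * q + s ^ 2 * q') := by
    intro s hs hss
    simp only [herm_add_left, herm_add_right, herm_smul_left, herm_smul_right, star_pow, hss, hvv,
      h11, h22, h21, h12, h20, h02]
    have hs4 : s ^ 4 = s := by linear_combination s * hs
    have hs5 : s ^ 5 = s ^ 2 := by linear_combination s ^ 2 * hs
    have hs6 : s ^ 6 = 1 := by linear_combination (s ^ 3 + 1) * hs
    ring_nf
    simp only [hs, hs4, hs5, hs6]
    ring
  have hAu : ∀ s : ℂ, s ^ 3 = 1 → toMat A *ᵥ (v + (s • v1 + s ^ 2 • v2))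
      = s ^ 2 • (v + (s • v1 + s ^ 2 • v2)) := by
    intro s hs
    have hs4 : s ^ 2 * s ^ 2 = s := by linear_combination s * hs
    have hs3 : s ^ 2 * s = 1 := by linear_combination hs
    rw [Matrix.mulVec_add, Matrix.mulVec_add, Matrix.mulVec_smul, Matrix.mulVec_smul, hv3,
      smul_add, smul_add, smul_smul, smul_smul, hs4, hs3, one_smul, ← hv1, ← hv2]
    abel
  -- The vectors `v + s Av + s² A²v`, over the cube roots of unity `s`, are three times the spectral
  -- components of the negative vector `v`. Their norms sum to `9 · (-2) = -18`, so one is negative.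
  have key : ∃ s : ℂ, s ^ 3 = 1 ∧
      (herm (v + (s • v1 + s ^ 2 • v2)) (v + (s • v1 + s ^ 2 • v2))).re < 0 := by
    by_contra! h
    have hw23 : (w ^ 2) ^ 3 = 1 := by linear_combination (w ^ 3 + 1) * hw3
    have e0 := h 1 (by norm_num)
    have e1 := h w hw3
    have e2 := h (w ^ 2) hw23
    rw [hu 1 (by norm_num) (by simp)] at e0
    rw [hu w hw3 hws] at e1
    rw [hu (w ^ 2) hw23 (by rw [star_pow, hws])] at e2
    have hsum : (-6 + 3 * (1 * q + 1 ^ 2 * q')) + (-6 + 3 * (w * q + w ^ 2 * q'))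
        + (-6 + 3 * (w ^ 2 * q + (w ^ 2) ^ 2 * q')) = -18 := by
      linear_combination (3 * q + 3 * q') * hw + 3 * q' * w * hw3
    have hre := congrArg Complex.re hsum
    rw [Complex.add_re, Complex.add_re] at hre
    norm_num at hre
    norm_num at e0 e1 e2
    linarith
  obtain ⟨s, hs, hneg⟩ := key
  refine ⟨_, hneg, ?_, s ^ 2, hAu s hs⟩
  intro h0
  rw [h0] at hneg
  simp [herm_eq] at hneg

/-! ### The deltoid. -/

/-- A number on the deltoid is the trace of a special unitary matrix with a double eigenvalue. -/
theorem exists_double_eigenvalue {t : ℂ}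
    (h : (t * star t) ^ 2 - 4 * (t ^ 3 + star t ^ 3) + 18 * (t * star t) - 27 = 0) :
    ∃ l : ℂ, l * star l = 1 ∧ t = 2 * l + star l ^ 2 := by
  obtain ⟨s, hs⟩ : ∃ s, s = star t := ⟨_, rfl⟩
  have hss : star s = t := by rw [hs, star_star]
  rw [← hs] at h
  -- The hypothesis is the vanishing discriminant of `x³ - t x² + s x - 1`. The root is `t/3` when
  -- triple, and otherwise the double root `(ts - 9) / (2(t² - 3s))`.
  by_cases hD : t ^ 2 - 3 * s = 0
  · have hD' : s ^ 2 - 3 * t = 0 := by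
      have := congrArg star hD
      simpa [hss, ← hs] using this
    have hts : t * s = 9 := by
      linear_combination (1 / 3) * h + (4 / 3 * t) * hD + (4 / 3 * s - t ^ 2 / 3) * hD' - t * hD
    refine ⟨t / 3, ?_, ?_⟩
    · rw [star_div₀, ← hs, star_ofNat]
      linear_combination hts / 9
    · rw [star_div₀, ← hs, star_ofNat]
      linear_combination -hD' / 9
  · have hsD : star (t ^ 2 - 3 * s) = s ^ 2 - 3 * t := by simp [hss, ← hs]
    have hD' : s ^ 2 - 3 * t ≠ 0 := by
      rw [← hsD]; exact star_ne_zero.2 hD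
    have hst : star (t * s - 9) = t * s - 9 := by simp [hss, ← hs]; ring
    have e : (t * s - 9) ^ 2 = 4 * ((t ^ 2 - 3 * s) * (s ^ 2 - 3 * t)) := by
      linear_combination (-3) * h
    have hl : star ((t * s - 9) / (2 * (t ^ 2 - 3 * s))) = (t * s - 9) / (2 * (s ^ 2 - 3 * t)) := by
      rw [star_div₀, hst, star_mul', hsD, star_ofNat]
    refine ⟨(t * s - 9) / (2 * (t ^ 2 - 3 * s)), ?_, ?_⟩
    · rw [hl, div_mul_div_comm, div_eq_one_iff_eq (by simp [hD, hD'])]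
      linear_combination e
    · rw [hl, div_pow, e]
      have e2 : (t * s - 9) * (s ^ 2 - 3 * t) + (t ^ 2 - 3 * s) ^ 2
          = t * ((t ^ 2 - 3 * s) * (s ^ 2 - 3 * t)) := by
        linear_combination (-t) * h
      generalize t ^ 2 - 3 * s = D at *
      generalize s ^ 2 - 3 * t = E at *
      field_simp
      linear_combination (-4) * e2

/-! ### The centre. -/

/-- Commuting with `diag(2, 1, 1/2)`, whose eigenvalues are distinct, forces a diagonal matrix;
commuting with a unipotent Heisenberg translation then equates the diagonal entries. -/
theorem center_scalar {C : SU21} (hC : C ∈ Subgroup.center SU21) :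
    ∃ c : ℂ, c * star c = 1 ∧ toMat C = c • 1 := by
  have hcomm : ∀ M : Matrix (Fin 3) (Fin 3) ℂ, M.det = 1 → Mᴴ * siegelForm * M = siegelForm →
      M * toMat C = toMat C * M := by
    intro M h1 h2
    have := Subgroup.mem_center_iff.1 hC ⟨⟨M, h1⟩, h2⟩
    exact congrArg toMat this
  have hd := hcomm !![2, 0, 0; 0, 1, 0; 0, 0, 1 / 2] (by simp [Matrix.det_fin_three]) (by
    ext i j
    fin_cases i <;> fin_cases j <;>
      simp [siegelForm, Matrix.mul_apply, Fin.sum_univ_three, Complex.conj_ofNat])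
  have hu := hcomm !![1, 1, -1 / 2; 0, 1, -1; 0, 0, 1] (by simp [Matrix.det_fin_three]) (by
    ext i j
    fin_cases i <;> fin_cases j <;>
      simp [siegelForm, Matrix.mul_apply, Fin.sum_univ_three, Complex.conj_ofNat]
    norm_num)
  have hform := toMat_form C
  generalize toMat C = M at hd hu hform
  have d := fun i j => congrFun (congrFun hd i) j
  have u := fun i j => congrFun (congrFun hu i) j
  have d01 := d 0 1
  have d02 := d 0 2
  have d10 := d 1 0
  have d12 := d 1 2
  have d20 := d 2 0
  have d21 := d 2 1
  have u01 := u 0 1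
  have u12 := u 1 2
  simp [Matrix.mul_apply, Fin.sum_univ_three] at d01 d02 d10 d12 d20 d21 u01 u12
  have m01 : M 0 1 = 0 := by linear_combination d01
  have m02 : M 0 2 = 0 := by linear_combination (2 / 3) * d02
  have m10 : M 1 0 = 0 := by linear_combination -d10
  have m12 : M 1 2 = 0 := by linear_combination 2 * d12
  have m20 : M 2 0 = 0 := by linear_combination (-2 / 3) * d20
  have m21 : M 2 1 = 0 := by linear_combination (-2) * d21
  have m11 : M 1 1 = M 0 0 := by
    simp [m01, m21] at u01
    linear_combination u01
  have m22 : M 2 2 = M 0 0 := by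
    simp [m10, m12] at u12
    rw [← m11]
    linear_combination u12
  refine ⟨M 0 0, ?_, ?_⟩
  · have := congrFun (congrFun hform 1) 1
    simp [siegelForm, Matrix.mul_apply, Fin.sum_univ_three, m01, m21, m11] at this
    simpa [mul_comm] using this
  · ext i j
    fin_cases i <;> fin_cases j <;> simp [m01, m02, m10, m12, m20, m21, m11, m22]

/-! ### The normal form and its trace identities. -/

/-- A normal form for elements of order three of `SU(2,1)`. -/
def cubicMat (h t : ℂ) : Matrix (Fin 3) (Fin 3) ℂ :=
  !![star h ^ 2, star h * star t, h; t, -star h ^ 2, 0; h, 0, 0]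

/-- The inverse of `cubicMat h t`. -/
def cubicMatInv (h t : ℂ) : Matrix (Fin 3) (Fin 3) ℂ :=
  !![0, 0, star h; 0, -h ^ 2, h * t; star h, star t, h ^ 2]

theorem siegelForm_conj_cubicMat (h t : ℂ) :
    siegelForm * (cubicMat h t)ᴴ * siegelForm = cubicMatInv h t := by
  have e : (cubicMat h t)ᴴ
      = !![h ^ 2, star t, star h; h * t, -h ^ 2, 0; star h, 0, 0] := by
    ext i j
    fin_cases i <;> fin_cases j <;> simp [cubicMat]
  rw [e]
  ext i j
  fin_cases i <;> fin_cases j <;>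
    simp [cubicMatInv, siegelForm, Matrix.mul_apply, Fin.sum_univ_three]

theorem det_cubicMat {h t : ℂ} (hh : h * star h = 1) : (cubicMat h t).det = 1 := by
  have e : (cubicMat h t).det = h ^ 2 * star h ^ 2 := by
    simp [cubicMat, Matrix.det_fin_three]; ring
  rw [e]
  linear_combination (h * star h + 1) * hh

theorem cubicMatInv_mul_cubicMat {h t : ℂ} (hh : h * star h = 1)
    (ht : t * star t = -(h ^ 3 + star h ^ 3)) :
    cubicMatInv h t * cubicMat h t = 1 := by
  simp only [cubicMat, cubicMatInv]
  generalize star h = k at *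
  generalize star t = s at *
  ext i j
  fin_cases i <;> fin_cases j <;>
    simp [Matrix.mul_apply, Fin.sum_univ_three] <;> grind

theorem cubicMat_form {h t : ℂ} (hh : h * star h = 1)
    (ht : t * star t = -(h ^ 3 + star h ^ 3)) :
    (cubicMat h t)ᴴ * siegelForm * cubicMat h t = siegelForm := by
  have e := cubicMatInv_mul_cubicMat hh ht
  rw [← siegelForm_conj_cubicMat, Matrix.mul_assoc, Matrix.mul_assoc] at e
  have := congrArg (siegelForm * ·) e
  simp only [← Matrix.mul_assoc, siegelForm_mul_self, Matrix.one_mul, Matrix.mul_one] at this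
  exact this

theorem cubicMat_cube {h t : ℂ} (hh : h * star h = 1)
    (ht : t * star t = -(h ^ 3 + star h ^ 3)) :
    cubicMat h t * cubicMat h t * cubicMat h t = 1 := by
  simp only [cubicMat]
  generalize star h = k at *
  generalize star t = s at *
  ext i j
  fin_cases i <;> fin_cases j <;>
    simp [Matrix.mul_apply, Fin.sum_univ_three] <;> grind

theorem trace_cubicMat (h t : ℂ) : (cubicMat h t).trace = 0 := by
  simp [cubicMat, Matrix.trace_fin_three]

theorem trace_cubicMat_mul (h t k s : ℂ) : (cubicMat h t * cubicMat k s).trace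
    = 2 * (h * k + star h ^ 2 * star k ^ 2) + star h * star t * s + star k * t * star s := by
  simp [cubicMat, Matrix.trace_fin_three]
  ring

theorem trace_cubicMat_mul_inv (h t k s : ℂ) : (cubicMat h t * cubicMatInv k s).trace
    = 2 * (h * star k) + star h ^ 2 * k ^ 2 := by
  simp [cubicMat, cubicMatInv, Matrix.trace_fin_three]
  ring

/-- In the application the two products on the right become `X` and `r²`, and the last summand
becomes `iY`, which splits twice the commutator trace into real and imaginary parts. -/
theorem trace_commutator_aux {h t k s : ℂ} (hh : h * star h = 1)
    (ht : t * star t = -(h ^ 3 + star h ^ 3)) (hk : k * star k = 1) :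
    2 * (cubicMat h t * cubicMat k s * cubicMatInv h t * cubicMatInv k s).trace
      = (2 * (h * star k) + star h ^ 2 * k ^ 2) * (2 * (star h * k) + h ^ 2 * star k ^ 2)
      + (2 * (h * k + star h ^ 2 * star k ^ 2) + star h * star t * s + star k * t * star s)
       * (2 * (star h * star k + h ^ 2 * k ^ 2) + h * t * star s + k * star t * s) - 3
      + (star k * t * star s - star h * star t * s) * (h * k) *
       (2 * (h * k + star h ^ 2 * star k ^ 2) + star h * star t * s + star k * t * star s) := by
  simp [cubicMat, cubicMatInv, Matrix.trace_fin_three]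
  simp only [Complex.star_def] at *
  generalize (starRingEnd ℂ) h = A at *
  generalize (starRingEnd ℂ) k = B at *
  generalize (starRingEnd ℂ) t = T at *
  generalize (starRingEnd ℂ) s = S at *
  grind

/-! ### From matrices to `SU21` and `PU21`. -/

open Classical in
/-- The element of `SU(2,1)` with a given matrix, or the identity if there is none. -/
noncomputable def ofMat (M : Matrix (Fin 3) (Fin 3) ℂ) : SU21 :=
  if h : ∃ A, toMat A = M then h.choose else 1

theorem toMat_ofMat {M : Matrix (Fin 3) (Fin 3) ℂ} (h1 : M.det = 1)
    (h2 : Mᴴ * siegelForm * M = siegelForm) : toMat (ofMat M) = M := by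
  have h : ∃ A, toMat A = M := ⟨⟨⟨M, h1⟩, h2⟩, rfl⟩
  rw [ofMat, dif_pos h]
  exact h.choose_spec

theorem toMat_inv_of_eq_cubicMat {A : SU21} {h t : ℂ} (hA : toMat A = cubicMat h t) :
    toMat A⁻¹ = cubicMatInv h t := by
  rw [toMat_inv, hA, siegelForm_conj_cubicMat]

/-- Elements of trace zero of `SU(2,1)` are not central. -/
theorem not_mem_center_of_trace_zero {A : SU21} (hA : (toMat A).trace = 0) :
    A ∉ Subgroup.center SU21 := by
  intro hC
  obtain ⟨c, hc, h⟩ := center_scalar hC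
  rw [h, Matrix.trace_smul, Matrix.trace_one, Fintype.card_fin, smul_eq_mul] at hA
  have : c = 0 := by simpa using hA
  simp [this] at hc

theorem orders_of_cube {A : SU21} (hA : (toMat A).trace = 0)
    (h3 : toMat A * toMat A * toMat A = 1) :
    IsEllipticSU A ∧ orderOf A = 3 ∧ orderOf (toPU A) = 3 := by
  have : Fact (Nat.Prime 3) := ⟨Nat.prime_three⟩
  have hA3 : A ^ 3 = 1 := by
    apply toMat_injective
    rw [pow_three', toMat_mul, toMat_mul, h3, toMat_one]
  have hc := not_mem_center_of_trace_zero hA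
  refine ⟨isEllipticSU_of_cube h3, orderOf_eq_prime hA3 ?_, orderOf_eq_prime ?_ ?_⟩
  · rintro rfl
    exact hc (Subgroup.one_mem _)
  · have : toPU A ^ 3 = toPU (A ^ 3) := rfl
    rw [this, hA3]
    rfl
  · intro h
    exact hc ((QuotientGroup.eq_one_iff A).1 h)

/-- Lifts of a conjugation in `PU21` agree up to central scalars, which have modulus one, so the
absolute value of the trace survives. -/
theorem norm_trace_eq_of_conj {A B A' B' : SU21}
    (h : ∃ g : PU21, g * toPU A * g⁻¹ = toPU A' ∧ g * toPU B * g⁻¹ = toPU B') :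
    ‖(toMat (A * B⁻¹)).trace‖ = ‖(toMat (A' * B'⁻¹)).trace‖ := by
  obtain ⟨g, h1, h2⟩ := h
  obtain ⟨G, rfl⟩ := QuotientGroup.mk_surjective g
  have h3 : toPU (G * (A * B⁻¹) * G⁻¹) = toPU (A' * B'⁻¹) := by
    have e1 : toPU (A' * B'⁻¹) = toPU A' * (toPU B')⁻¹ := rfl
    have e2 : toPU (G * (A * B⁻¹) * G⁻¹)
        = QuotientGroup.mk G * (toPU A * (toPU B)⁻¹) * (QuotientGroup.mk G)⁻¹ := rfl
    rw [e1, e2, ← h1, ← h2]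
    group
  obtain ⟨c, hc, hC⟩ := center_scalar (QuotientGroup.eq.1 h3)
  have h4 : toMat (A' * B'⁻¹) = c • toMat (G * (A * B⁻¹) * G⁻¹) := by
    have : A' * B'⁻¹ = (G * (A * B⁻¹) * G⁻¹) * ((G * (A * B⁻¹) * G⁻¹)⁻¹ * (A' * B'⁻¹)) := by
      group
    rw [this, toMat_mul, hC, Matrix.mul_smul, Matrix.mul_one]
  have hcn : ‖c‖ = 1 := by
    have := congrArg norm hc
    rw [norm_mul, norm_star, norm_one] at this
    nlinarith [norm_nonneg c]
  rw [h4, Matrix.trace_smul, trace_toMat_conj, smul_eq_mul, norm_mul, hcn, one_mul]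

/-- Two elements of order three whose products `A B` and `A B⁻¹` have nonzero traces on the
deltoid, and whose commutator has its trace on the deltoid away from its two other cusps, generate
a group in which these three elements are parabolic. -/
theorem isParabolicSU_triple {A B : SU21} (hA : (toMat A).trace = 0)
    (hA3 : toMat A * toMat A * toMat A = 1) (hB : (toMat B).trace = 0)
    (hB3 : toMat B * toMat B * toMat B = 1) {l m n : ℂ} (hl : l * star l = 1)
    (hm : m * star m = 1) (hn : n * star n = 1)
    (hAB : (toMat (A * B)).trace = 2 * l + star l ^ 2)
    (hAB' : (toMat (A * B⁻¹)).trace = 2 * m + star m ^ 2)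
    (hc : (toMat (A * B * A⁻¹ * B⁻¹)).trace = 2 * n + star n ^ 2)
    (hl0 : (toMat (A * B)).trace ≠ 0) (hm0 : (toMat (A * B⁻¹)).trace ≠ 0)
    (hre : -3 / 2 < (toMat (A * B * A⁻¹ * B⁻¹)).trace.re) :
    IsParabolicSU (A * B) ∧ IsParabolicSU (A * B⁻¹) ∧ IsParabolicSU (A * B * A⁻¹ * B⁻¹) := by
  have hBi : (toMat B⁻¹).trace = 0 := by rw [trace_toMat_inv, hB, star_zero]
  have cube : ∀ {C : SU21}, toMat C * toMat C * toMat C = 1 → C ^ 3 = 1 := by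
    intro C h
    apply toMat_injective
    rw [pow_three', toMat_mul, toMat_mul, h, toMat_one]
  have cube' : ∀ {C : SU21}, C ^ 3 = 1 → toMat C * toMat C * toMat C = 1 := by
    intro C h
    rw [← toMat_mul, ← toMat_mul, ← pow_three', h, toMat_one]
  have A3 := cube hA3
  have B3 := cube hB3
  have B2 : B⁻¹ = B * B := by
    rw [inv_eq_iff_mul_eq_one, ← pow_three, B3]
  have Bi3 : (B⁻¹) ^ 3 = 1 := by rw [inv_pow, B3, inv_one]
  have p1 : IsParabolicSU (A * B) := by
    refine isParabolicSU_mul_of_trace_zero hA hB hB3 hl hAB ?_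
    intro h
    apply hm0
    -- If `A B` were the scalar `l`, then `A B⁻¹ = A B²` would be `l B`, of trace zero.
    have : A * B⁻¹ = A * B * B := by rw [B2, mul_assoc]
    rw [this, toMat_mul, h, Matrix.smul_mul, Matrix.one_mul, Matrix.trace_smul, hB, smul_zero]
  have p2 : IsParabolicSU (A * B⁻¹) := by
    refine isParabolicSU_mul_of_trace_zero hA hBi (cube' Bi3) hm hAB' ?_
    intro h
    apply hl0
    have : A * B = A * B⁻¹ * B⁻¹ := by
      rw [mul_assoc, ← _root_.mul_inv_rev, ← B2, inv_inv]
    rw [this, toMat_mul, h, Matrix.smul_mul, Matrix.one_mul, Matrix.trace_smul, hBi, smul_zero]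
  refine ⟨p1, p2, ?_⟩
  have hcom : A * B * A⁻¹ * B⁻¹ = A * (B * A⁻¹ * B⁻¹) := by group
  rw [hcom] at hc hre ⊢
  have hK : (toMat (B * A⁻¹ * B⁻¹)).trace = 0 := by
    rw [trace_toMat_conj, trace_toMat_inv, hA, star_zero]
  have hK3 : (B * A⁻¹ * B⁻¹) ^ 3 = 1 := by
    rw [conj_pow, inv_pow, A3]; group
  refine isParabolicSU_mul_of_trace_zero hA hK (cube' hK3) hn hc ?_
  intro h
  have hdet := det_toMat (A * (B * A⁻¹ * B⁻¹))
  rw [h, Matrix.det_smul, Matrix.det_one, Fintype.card_fin, mul_one] at hdet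
  rw [h, Matrix.trace_smul, Matrix.trace_one, Fintype.card_fin, smul_eq_mul] at hre
  -- A scalar commutator has `n³ = 1`; for `n ≠ 1` its trace has real part `-3/2`, which `hre`
  -- excludes. With `n = 1` the elements commute, so `(A B)³ = 1` and `A B` is elliptic.
  have hn1 : n = 1 := by
    by_contra hne
    have hq : n ^ 2 + n + 1 = 0 := by
      apply mul_left_cancel₀ (sub_ne_zero.2 hne)
      linear_combination hdet
    have hs : star n = n ^ 2 := by
      linear_combination n ^ 2 * hn - star n * hdet
    have := congrArg Complex.re (show n + star n = -1 by rw [hs]; linear_combination hq)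
    simp at this hre
    linarith
  rw [hn1, one_smul, ← toMat_one] at h
  have hcomm : A * B = B * A := by
    have h5 := toMat_injective h
    rw [← hcom, mul_inv_eq_one, mul_inv_eq_iff_eq_mul] at h5
    exact h5
  have hAB3 : (A * B) ^ 3 = 1 := by
    rw [Commute.mul_pow hcomm, A3, B3, one_mul]
  exact p1.1 (isEllipticSU_of_cube (cube' hAB3))

/-! ### The root of the quartic. -/

/-- The quadratic polynomial that is nonpositive exactly on `pinchInterval`. -/
theorem quadratic_nonpos_of_mem {X : ℝ} (hX : X ∈ pinchInterval) :
    2 * X ^ 2 - 18 * X + 27 ≤ 0 := by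
  obtain ⟨h1, h2⟩ := hX
  have h3 := Real.sq_sqrt (show (0 : ℝ) ≤ 3 by norm_num)
  nlinarith [mul_nonneg (sub_nonneg.2 h1) (sub_nonneg.2 h2)]

/-- `pinchPoly` as a polynomial in `X` and `t = Y ^ 2`. -/
def pinchQuartic (X t : ℝ) : ℝ :=
  t ^ 4 + 4 * (4 * X ^ 2 - 14 * X + 27) * t ^ 3
    + 6 * (12 * X ^ 4 - 8 * X ^ 3 + 360 * X ^ 2 - 756 * X + 729) * t ^ 2
    + 4 * (16 * X ^ 6 - 24 * X ^ 5 + 1404 * X ^ 4 - 4536 * X ^ 3 + 20412 * X ^ 2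
        - 30618 * X + 19683) * t
    + (2 * X ^ 2 - 2 * X + 27) * (2 * X ^ 2 - 18 * X + 27) ^ 3

theorem pinchPoly_eq (X Y : ℝ) : pinchPoly X Y = pinchQuartic X (Y ^ 2) := by
  simp only [pinchPoly, pinchQuartic]; ring

theorem pinchQuartic_coeff_three_pos (X : ℝ) : 0 < 4 * X ^ 2 - 14 * X + 27 := by
  nlinarith [sq_nonneg (4 * X - 7)]

theorem pinchQuartic_coeff_two_pos (X : ℝ) :
    0 < 12 * X ^ 4 - 8 * X ^ 3 + 360 * X ^ 2 - 756 * X + 729 := by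
  nlinarith [sq_nonneg (X * (3 * X - 1)), sq_nonneg (X - 1), sq_nonneg X]

theorem pinchQuartic_coeff_one_pos (X : ℝ) :
    0 < 16 * X ^ 6 - 24 * X ^ 5 + 1404 * X ^ 4 - 4536 * X ^ 3 + 20412 * X ^ 2
        - 30618 * X + 19683 := by
  nlinarith [sq_nonneg (X ^ 2 * (4 * X - 3)), sq_nonneg (X * (X - 2)), sq_nonneg (4 * X - 3),
    sq_nonneg (X ^ 2), sq_nonneg X]

theorem pinchQuartic_strictMonoOn (X : ℝ) : StrictMonoOn (pinchQuartic X) (Set.Ici 0) := by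
  intro s hs t ht hst
  have h3 := pinchQuartic_coeff_three_pos X
  have h2 := pinchQuartic_coeff_two_pos X
  have h1 := pinchQuartic_coeff_one_pos X
  have hs : 0 ≤ s := hs
  simp only [pinchQuartic]
  gcongr

theorem continuous_pinchQuartic : Continuous fun p : ℝ × ℝ => pinchQuartic p.1 p.2 := by
  unfold pinchQuartic; fun_prop

theorem exists_root_pinchQuartic {X : ℝ} (hX : 2 * X ^ 2 - 18 * X + 27 ≤ 0) :
    ∃ t, 0 ≤ t ∧ t ≤ -(2 * X ^ 2 - 18 * X + 27) ∧ pinchQuartic X t = 0 := by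
  have h3 := pinchQuartic_coeff_three_pos X
  have h2 := pinchQuartic_coeff_two_pos X
  have h1 := pinchQuartic_coeff_one_pos X
  have hc : Continuous (pinchQuartic X) :=
    continuous_pinchQuartic.comp (Continuous.prodMk_right X)
  have h0 : pinchQuartic X 0 ≤ 0 := by
    have : pinchQuartic X 0 = (2 * X ^ 2 - 2 * X + 27) * (2 * X ^ 2 - 18 * X + 27) ^ 3 := by
      simp only [pinchQuartic]; ring
    rw [this]
    apply mul_nonpos_of_nonneg_of_nonpos
    · nlinarith [sq_nonneg (X - 1), sq_nonneg X]
    · exact Odd.pow_nonpos (by decide) hX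
  -- With `2XZ = 27 + t`, the bound `t ≤ e` says `X + Z ≤ 9`; it later keeps `r² = Z` below 9.
  set e := -(2 * X ^ 2 - 18 * X + 27) with he
  have he0 : 0 ≤ e := by rw [he]; linarith
  have hE : 0 ≤ pinchQuartic X e := by
    have : pinchQuartic X e = 2 * e ^ 4 + 8 * (2 * X ^ 2 - 9 * X + 27 / 2) * e ^ 3
        + 6 * (12 * X ^ 4 - 8 * X ^ 3 + 360 * X ^ 2 - 756 * X + 729) * e ^ 2
        + 4 * (16 * X ^ 6 - 24 * X ^ 5 + 1404 * X ^ 4 - 4536 * X ^ 3 + 20412 * X ^ 2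
        - 30618 * X + 19683) * e := by
      simp only [pinchQuartic, he]; ring
    rw [this]
    have h4 : 0 < 2 * X ^ 2 - 9 * X + 27 / 2 := by nlinarith [sq_nonneg (4 * X - 9)]
    positivity
  obtain ⟨t, ht, h⟩ := intermediate_value_Icc he0 hc.continuousOn ⟨h0, hE⟩
  exact ⟨t, ht.1, ht.2, h⟩

/-- The nonnegative root of an equation strictly increasing in the unknown depends continuously
on the parameter. -/
theorem continuousOn_root {F : ℝ → ℝ → ℝ} {I : Set ℝ} {T : ℝ → ℝ}
    (hF : Continuous fun p : ℝ × ℝ => F p.1 p.2) (hmono : ∀ X, StrictMonoOn (F X) (Set.Ici 0))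
    (hT : ∀ X ∈ I, 0 ≤ T X ∧ F X (T X) = 0) : ContinuousOn T I := by
  intro X hX
  have hcont : ∀ b, Filter.Tendsto (fun x => F x b) (nhdsWithin X I) (nhds (F X b)) := fun b =>
    ((hF.comp (Continuous.prodMk_left b)).continuousAt (x := X)).continuousWithinAt
  obtain ⟨h0, hr⟩ := hT X hX
  refine tendsto_order.2 ⟨fun b hb => ?_, fun b hb => ?_⟩
  · by_cases hb0 : b < 0
    · filter_upwards [self_mem_nhdsWithin] with x hx
      exact hb0.trans_le (hT x hx).1
    · have hb0 : 0 ≤ b := not_lt.1 hb0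
      have h1 : F X b < 0 := hr ▸ hmono X hb0 h0 hb
      filter_upwards [self_mem_nhdsWithin, (hcont b).eventually_lt_const h1] with x hx hxb
      rw [← (hT x hx).2] at hxb
      exact ((hmono x).lt_iff_lt hb0 (hT x hx).1).1 hxb
  · have hb0 : 0 ≤ b := h0.trans hb.le
    have h1 : 0 < F X b := hr ▸ hmono X h0 hb0 hb
    filter_upwards [self_mem_nhdsWithin, (hcont b).eventually_const_lt h1] with x hx hxb
    rw [← (hT x hx).2] at hxb
    exact ((hmono x).lt_iff_lt (hT x hx).1 hb0).1 hxb

/-! ### The family over one value of the parameter. -/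

theorem commutator_trace_deltoid {X Y Z x y : ℝ} (hX : X ≠ 0) (hZ : 2 * X * Z = 27 + Y ^ 2)
    (hP : pinchPoly X Y = 0) (hx : x = (X + Z - 3) / 2) (hy : y = Y / 2) :
    (x ^ 2 + y ^ 2) ^ 2 - 8 * (x ^ 3 - 3 * x * y ^ 2) + 18 * (x ^ 2 + y ^ 2) - 27 = 0 := by
  have hZ' : Z = (27 + Y ^ 2) / (2 * X) := by field_simp; linarith
  have : (x ^ 2 + y ^ 2) ^ 2 - 8 * (x ^ 3 - 3 * x * y ^ 2) + 18 * (x ^ 2 + y ^ 2) - 27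
      = pinchPoly X Y / (256 * X ^ 4) := by
    rw [hx, hy, hZ', pinchPoly]
    field_simp
    ring
  rw [this, hP, zero_div]

/-- Bounds for the squared moduli `X` and `Z` of the traces of `J₁ J₂⁻¹` and `J₁ J₂`. -/
theorem trace_sq_bounds {X t Z : ℝ} (hX : 2 * X ^ 2 - 18 * X + 27 ≤ 0) (ht : 0 ≤ t)
    (hZ : 2 * X * Z = 27 + t) : 1 < X ∧ X < 9 ∧ 3 / 2 < Z := by
  have h1 : 1 < X := by nlinarith
  have h2 : X < 8 := by nlinarith
  exact ⟨h1, by linarith, by nlinarith⟩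

/-- The inequality that makes the second coordinates of the two normal forms nonzero. -/
theorem mul_add_mul_neg {X Y r C S D E : ℝ} (hX : 2 * X ^ 2 - 18 * X + 27 ≤ 0) (hr : 0 < r)
    (hZ : 2 * X * r ^ 2 = 27 + Y ^ 2) (hP : pinchPoly X Y = 0)
    (hC : 8 * r ^ 3 * C = -(r ^ 4 + 18 * r ^ 2 - 27)) (hD : 8 * D ^ 2 = X - 1)
    (hCS : C ^ 2 + S ^ 2 = 1) (hDE : D ^ 2 + E ^ 2 = 1) (hD0 : 0 < D) (hS : 0 ≤ S) (hE : 0 ≤ E) :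
    4 * ((C * D) ^ 2 - (S * E) ^ 2) = ((-r - 4 * C) / 2) ^ 2 + (-Y / (2 * r)) ^ 2 ∧
      C * D + S * E < 0 := by
  obtain ⟨hX1, hX9, hZ1⟩ := trace_sq_bounds hX (sq_nonneg Y) hZ
  have hCneg : C < 0 := by
    have h1 : 8 * r ^ 3 * C < 0 := by rw [hC]; nlinarith
    by_contra h
    have : 0 ≤ 8 * r ^ 3 * C := mul_nonneg (by positivity) (not_lt.1 h)
    linarith
  have key : 4 * ((C * D) ^ 2 - (S * E) ^ 2)
      = ((-r - 4 * C) / 2) ^ 2 + (-Y / (2 * r)) ^ 2 := by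
    have e1 : (C * D) ^ 2 - (S * E) ^ 2 = C ^ 2 - E ^ 2 := by
      linear_combination C ^ 2 * hDE - E ^ 2 * hCS
    rw [e1]
    field_simp
    linear_combination 2 * r ^ 2 * (hD - 8 * hDE) - hC + hZ
  refine ⟨key, ?_⟩
  -- This is `|u|²`. Its vanishing would give `Y = 0` and `r = -4C`, hence `r² = 9 - X` and finally
  -- `r² (X - 9) = 0`.
  have hpos : 0 < ((-r - 4 * C) / 2) ^ 2 + (-Y / (2 * r)) ^ 2 := by
    by_contra h
    have h1 : ((-r - 4 * C) / 2) ^ 2 = 0 := by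
      linarith [sq_nonneg ((-r - 4 * C) / 2), sq_nonneg (-Y / (2 * r))]
    have h2 : (-Y / (2 * r)) ^ 2 = 0 := by
      linarith [sq_nonneg ((-r - 4 * C) / 2), sq_nonneg (-Y / (2 * r))]
    have hY : Y = 0 := by simpa [hr.ne'] using h2
    have hrC : r = -4 * C := by
      have := pow_eq_zero_iff (two_ne_zero) |>.1 h1
      linarith
    rw [hY, pinchPoly_eq] at hP
    have hP' : (2 * X ^ 2 - 2 * X + 27) * (2 * X ^ 2 - 18 * X + 27) ^ 3 = 0 := by
      rw [← hP, pinchQuartic]; ring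
    have hq : 2 * X ^ 2 - 18 * X + 27 = 0 := by
      rcases mul_eq_zero.1 hP' with h | h
      · nlinarith
      · exact pow_eq_zero_iff (three_ne_zero) |>.1 h
    rw [hY] at hZ
    have h3 : r ^ 2 = 9 - X := by
      have : 2 * X * (r ^ 2 - (9 - X)) = 0 := by linear_combination hZ + hq
      rcases mul_eq_zero.1 this with h | h <;> linarith
    have h4 : r ^ 4 - 18 * r ^ 2 + 27 = 0 := by
      linear_combination -hC + 2 * r ^ 3 * hrC
    have h5 : (r ^ 2) * (X - 9) = 0 := by
      linear_combination h4 + hZ - r ^ 2 * h3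
    rcases mul_eq_zero.1 h5 with h | h
    · linarith
    · linarith
  rw [← key] at hpos
  have h1 : C * D < 0 := mul_neg_of_neg_of_pos hCneg hD0
  have h2 : 0 ≤ S * E := mul_nonneg hS hE
  nlinarith

/-- The real part of `u` is chosen to make `tr(AB) = -(star k) r`, and its imaginary part to give
the commutator trace imaginary part `Y/2`. The value of `a²` is what the normal form of `B` demands;
that of `A` then demands `|u|² = 4((CD)² - (SE)²)`, which is `hkey`. -/
theorem family_properties {X Y r C S D E : ℝ} {k m : ℂ} {a : ℝ} {u : ℂ} {A B : SU21}
    (hX : 2 * X ^ 2 - 18 * X + 27 ≤ 0) (hr : 0 < r)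
    (hZ : 2 * X * r ^ 2 = 27 + Y ^ 2) (hP : pinchPoly X Y = 0)
    (hC : 8 * r ^ 3 * C = -(r ^ 4 + 18 * r ^ 2 - 27)) (hD : 8 * D ^ 2 = X - 1)
    (hCS : C ^ 2 + S ^ 2 = 1) (hDE : D ^ 2 + E ^ 2 = 1) (hD0 : 0 < D) (hS : 0 ≤ S) (hE : 0 ≤ E)
    (hk : k * star k = 1) (hm : m * star m = 1) (hk3 : k ^ 3 = C + S * Complex.I)
    (hm3 : m ^ 3 = D + E * Complex.I) (ha : a = √(-2 * (C * D + S * E)))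
    (hu : u = ((-r - 4 * C) / 2 : ℝ) + (-Y / (2 * r) : ℝ) * Complex.I)
    (hA : A = ofMat (cubicMat (k * m) (u * star m / a)))
    (hB : B = ofMat (cubicMat (k * star m) a)) :
    toMat A = cubicMat (k * m) (u * star m / a) ∧ toMat B = cubicMat (k * star m) a ∧
    (IsEllipticSU A ∧ orderOf A = 3 ∧ orderOf (toPU A) = 3) ∧
    (IsEllipticSU B ∧ orderOf B = 3 ∧ orderOf (toPU B) = 3) ∧
    IsParabolicSU (A * B) ∧ IsParabolicSU (A * B⁻¹) ∧ IsParabolicSU (A * B * A⁻¹ * B⁻¹) ∧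
    ‖(toMat (A * B⁻¹)).trace‖ ^ 2 = X ∧
    (toMat (A * B * A⁻¹ * B⁻¹)).trace = (((2 * X ^ 2 - 6 * X + 27 + Y ^ 2 : ℝ) : ℂ)
            + 2 * Complex.I * (X : ℂ) * (Y : ℂ)) / (4 * (X : ℂ)) := by
  obtain ⟨hX1, hX9, hZ1⟩ := trace_sq_bounds hX (sq_nonneg Y) hZ
  obtain ⟨hkey, hneg⟩ := mul_add_mul_neg hX hr hZ hP hC hD hCS hDE hD0 hS hE
  have hX0 : (X : ℂ) ≠ 0 := by exact_mod_cast (by linarith : X ≠ 0)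
  have hr0 : (r : ℂ) ≠ 0 := by exact_mod_cast hr.ne'
  have hapos : 0 < a := by rw [ha]; apply Real.sqrt_pos.2; linarith
  have ha2 : a ^ 2 = -2 * (C * D + S * E) := by rw [ha, Real.sq_sqrt]; linarith
  have ha0 : (a : ℂ) ≠ 0 := by exact_mod_cast hapos.ne'
  have ha2' : (a : ℂ) ^ 2 = -2 * (C * D + S * E) := by exact_mod_cast ha2
  have hI := Complex.I_mul_I
  have hsu : star u = ((-r - 4 * C) / 2 : ℝ) - (-Y / (2 * r) : ℝ) * Complex.I := by
    rw [hu]; simp only [Complex.star_def, map_add, map_mul, Complex.conj_ofReal, Complex.conj_I]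
    ring
  have huu : u * star u = 4 * ((C * D) ^ 2 - (S * E) ^ 2) := by
    have h : ((4 * ((C * D) ^ 2 - (S * E) ^ 2) : ℝ) : ℂ)
      = ((((-r - 4 * C) / 2) ^ 2 + (-Y / (2 * r)) ^ 2 : ℝ) : ℂ) := by rw [hkey]
    rw [hsu, hu]
    push_cast at h ⊢
    rw [h]
    linear_combination (-(-(Y : ℂ) / (2 * r)) ^ 2) * hI
  have hsk3 : star k ^ 3 = C - S * Complex.I := by
    rw [← star_pow, hk3]; simp; ring
  have hsm3 : star m ^ 3 = D - E * Complex.I := by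
    rw [← star_pow, hm3]; simp; ring
  have hsa : star (a : ℂ) = a := Complex.conj_ofReal a
  set t := u * star m / a with ht
  have hst : star t = star u * m / a := by
    rw [ht, star_div₀, star_mul', star_star, hsa]
  have hAh : (k * m) * star (k * m) = 1 := by
    rw [star_mul']; linear_combination (m * star m) * hk + hm
  have hBh : (k * star m) * star (k * star m) = 1 := by
    rw [star_mul', star_star]; linear_combination (m * star m) * hk + hm
  have hAt : t * star t = -((k * m) ^ 3 + star (k * m) ^ 3) := by
    have e1 : t * star t * a ^ 2 = u * star u := by
      rw [hst, ht]; field_simp; linear_combination (u * star u) * hm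
    apply mul_right_cancel₀ (pow_ne_zero 2 ha0)
    rw [e1, huu, star_mul', mul_pow k, mul_pow (star k), hk3, hm3, hsk3, hsm3, ha2']
    linear_combination (-4 * S * E * (C * D + S * E)) * hI
  have hBt : (a : ℂ) * star (a : ℂ) = -((k * star m) ^ 3 + star (k * star m) ^ 3) := by
    rw [hsa, star_mul', star_star, mul_pow, mul_pow, hk3, hm3, hsk3, hsm3, ← sq, ha2']
    linear_combination (-2 * S * E) * hI
  have hA' : toMat A = cubicMat (k * m) t := by
    rw [hA, toMat_ofMat (det_cubicMat hAh) (cubicMat_form hAh hAt)]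
  have hB' : toMat B = cubicMat (k * star m) a := by
    rw [hB, toMat_ofMat (det_cubicMat hBh) (cubicMat_form hBh hBt)]
  have hAtr : (toMat A).trace = 0 := by rw [hA', trace_cubicMat]
  have hBtr : (toMat B).trace = 0 := by rw [hB', trace_cubicMat]
  have hA3 : toMat A * toMat A * toMat A = 1 := by rw [hA', cubicMat_cube hAh hAt]
  have hB3 : toMat B * toMat B * toMat B = 1 := by rw [hB', cubicMat_cube hBh hBt]
  have q1 : star (k * m) * star t * a = star k * star u := by
    rw [star_mul', hst]; field_simp; linear_combination (star k * star u) * hm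
  have q2 : star (k * star m) * t * star (a : ℂ) = star k * u := by
    rw [star_mul', star_star, hsa, ht]; field_simp; linear_combination (star k * u) * hm
  have hsk2 : star k ^ 2 * k ^ 2 = 1 := by linear_combination (k * star k + 1) * hk
  have hsm2 : star m ^ 2 * m ^ 2 = 1 := by linear_combination (m * star m + 1) * hm
  have hz : 2 * ((k * m) * (k * star m) + star (k * m) ^ 2 * star (k * star m) ^ 2)
      + star (k * m) * star t * a + star (k * star m) * t * star (a : ℂ) = -(star k * r) := by
    rw [q1, q2, hsu, hu]
    simp only [star_mul', star_star]
    push_cast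
    linear_combination (2 * k ^ 2 + 2 * star k ^ 4 * (m * star m + 1)) * hm - 2 * k ^ 2 * hk
      + 2 * star k * (hk3 + hsk3)
  have hw : 2 * ((k * m) * star (k * star m)) + star (k * m) ^ 2 * (k * star m) ^ 2
      = 2 * m ^ 2 + star (m ^ 2) ^ 2 := by
    simp only [star_mul', star_star, star_pow]
    linear_combination (2 * m ^ 2) * hk + star m ^ 4 * hsk2
  have hAB : (toMat (A * B)).trace = -(star k * r) := by
    rw [toMat_mul, hA', hB', trace_cubicMat_mul, hz]
  have hAB' : (toMat (A * B⁻¹)).trace = 2 * m ^ 2 + star (m ^ 2) ^ 2 := by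
    rw [toMat_mul, hA', toMat_inv_of_eq_cubicMat hB', trace_cubicMat_mul_inv, hw]
  have hww : (2 * m ^ 2 + star (m ^ 2) ^ 2) * star (2 * m ^ 2 + star (m ^ 2) ^ 2) = X := by
    have h8 : (8 : ℂ) * D ^ 2 = X - 1 := by exact_mod_cast hD
    have hde : (D : ℂ) ^ 2 + E ^ 2 = 1 := by exact_mod_cast hDE
    have hsm4 : star m ^ 4 * m ^ 4 = 1 := by
      linear_combination (star m ^ 2 * m ^ 2 + 1) * hsm2
    have h6 : m ^ 6 + star m ^ 6 = 2 * (D ^ 2 - E ^ 2) := by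
      have e1 : m ^ 6 = (m ^ 3) ^ 2 := by ring
      have e2 : star m ^ 6 = (star m ^ 3) ^ 2 := by ring
      rw [e1, e2, hm3, hsm3]
      linear_combination (2 * (E : ℂ) ^ 2) * hI
    simp only [star_add, star_mul', star_pow, star_star, star_ofNat]
    linear_combination 4 * hsm2 + hsm4 + 2 * h6 + h8 - 4 * hde
  have hnorm : ‖(toMat (A * B⁻¹)).trace‖ ^ 2 = X := by
    have h := Complex.mul_conj' (toMat (A * B⁻¹)).trace
    rw [← Complex.star_def, hAB', hww] at h
    rw [hAB']
    exact_mod_cast h.symm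
  have hc : (toMat (A * B * A⁻¹ * B⁻¹)).trace
      = ((X + r ^ 2 - 3) / 2 : ℝ) + (Y / 2 : ℝ) * Complex.I := by
    have h := trace_commutator_aux (t := t) (s := a) hAh hAt hBh
    rw [hz, hw] at h
    have h2 : 2 * (star (k * m) * (k * star m)) + (k * m) ^ 2 * star (k * star m) ^ 2
        = star (2 * m ^ 2 + star (m ^ 2) ^ 2) := by
      simp only [star_add, star_mul', star_star, star_pow, star_ofNat]
      linear_combination (2 * star m ^ 2) * hk + m ^ 4 * hsk2
    have h3 : 2 * (star (k * m) * star (k * star m) + (k * m) ^ 2 * (k * star m) ^ 2)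
        + (k * m) * t * star (a : ℂ) + (k * star m) * star t * a = -(k * r) := by
      have := congrArg star hz
      simp only [star_add, star_mul', star_star, star_pow, star_ofNat, star_neg, hsa,
        show star (r : ℂ) = r from Complex.conj_ofReal r] at this ⊢
      linear_combination this
    rw [h2, h3, hww, q1, q2] at h
    rw [toMat_mul, toMat_mul, toMat_mul, toMat_inv_of_eq_cubicMat hB',
      toMat_inv_of_eq_cubicMat hA', hA', hB']
    have h4 : u - star u = -Y / r * Complex.I := by
      rw [hsu, hu]; push_cast; ring
    have h5 : (star k * u - star k * star u) * (k * m * (k * star m)) * -(star k * r)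
        = Y * Complex.I := by
      have : (star k * u - star k * star u) * (k * m * (k * star m)) * -(star k * r)
        = -(u - star u) * r := by
        linear_combination (-(u - star u) * r) * (hsk2 * (m * star m) + hm)
      rw [this, h4]
      field_simp
    rw [h5] at h
    push_cast
    linear_combination h / 2 + r ^ 2 / 2 * hk
  have hsz : star (-(star k * (r : ℂ))) = -(k * r) := by
    simp only [star_neg, star_mul', star_star, show star (r : ℂ) = r from Complex.conj_ofReal r]
  -- For this trace the deltoid equation reads `r⁴ + 8r³C + 18r² - 27 = 0`, which is `hC`.
  obtain ⟨l, hl, hl'⟩ := exists_double_eigenvalue (t := -(star k * (r : ℂ))) (by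
    rw [hsz]
    have hC' : (8 : ℂ) * r ^ 3 * C = -(r ^ 4 + 18 * r ^ 2 - 27) := by exact_mod_cast hC
    linear_combination (r ^ 4 * (k * star k + 1) + 18 * r ^ 2) * hk
      + 4 * r ^ 3 * (hk3 + hsk3) + hC')
  set x := (X + r ^ 2 - 3) / 2 with hx
  set y := Y / 2 with hy
  have hdelt := commutator_trace_deltoid (by linarith : X ≠ 0) hZ hP hx hy
  obtain ⟨n, hn, hn'⟩ := exists_double_eigenvalue (t := (x : ℂ) + y * Complex.I) (by
    have hs : star ((x : ℂ) + y * Complex.I) = x - y * Complex.I := by simp; ring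
    have hd : ((x : ℂ) ^ 2 + y ^ 2) ^ 2 - 8 * (x ^ 3 - 3 * x * y ^ 2) + 18 * (x ^ 2 + y ^ 2) - 27
      = 0 := by exact_mod_cast hdelt
    have e1 : ((x : ℂ) + y * Complex.I) * (x - y * Complex.I) = x ^ 2 + y ^ 2 := by
      linear_combination (-(y : ℂ) ^ 2) * hI
    have e2 : ((x : ℂ) + y * Complex.I) ^ 3 + (x - y * Complex.I) ^ 3
        = 2 * (x ^ 3 - 3 * x * y ^ 2) := by
      linear_combination (6 * (x : ℂ) * y ^ 2) * hI
    rw [hs, e1, e2]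
    linear_combination hd)
  have hk0 : star k ≠ 0 := right_ne_zero_of_mul_eq_one hk
  obtain ⟨p1, p2, p3⟩ := isParabolicSU_triple hAtr hA3 hBtr hB3 hl
    (m := m ^ 2) (by rw [star_pow]; linear_combination hsm2) hn (hAB.trans hl') hAB'
    (hc.trans hn') (by rw [hAB]; exact neg_ne_zero.2 (mul_ne_zero hk0 hr0))
    (by
      intro h
      rw [h, norm_zero] at hnorm
      norm_num at hnorm
      linarith)
    (by
      rw [hc]
      simp
      nlinarith)
  refine ⟨hA', hB', orders_of_cube hAtr hA3, orders_of_cube hBtr hB3, p1, p2, p3, hnorm, ?_⟩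
  rw [hc, eq_div_iff (mul_ne_zero (by norm_num : (4 : ℂ) ≠ 0) hX0), hx, hy]
  have hZ' : (2 : ℂ) * X * r ^ 2 = 27 + Y ^ 2 := by exact_mod_cast hZ
  push_cast
  linear_combination hZ'

/-! ### Continuity and assembly. -/

theorem continuous_cubicMat : Continuous fun p : ℂ × ℂ => cubicMat p.1 p.2 := by
  refine continuous_matrix fun i j => ?_
  fin_cases i <;> fin_cases j <;> simp [cubicMat] <;> fun_prop

theorem exp_mul_I_unit (x : ℝ) :
    Complex.exp (x * Complex.I) * star (Complex.exp (x * Complex.I)) = 1 := by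
  rw [Complex.star_def, ← Complex.exp_conj, ← Complex.exp_add]
  simp

theorem exp_third_cube (x : ℝ) : Complex.exp ((x / 3 : ℝ) * Complex.I) ^ 3
    = (Real.cos x : ℝ) + (Real.sin x : ℝ) * Complex.I := by
  rw [← Complex.exp_nat_mul, Complex.ofReal_cos, Complex.ofReal_sin, ← Complex.exp_mul_I]
  congr 1
  push_cast
  ring

/-- The circle of radius `r` meets the deltoid for `1 ≤ r ≤ 3`, as the factor `(9 - r²)³ (r² - 1)`
shows; this makes `arccos` legitimate below. -/
theorem abs_angle_bound {r : ℝ} (hr : 0 < r) (h1 : 1 ≤ r ^ 2) (h9 : r ^ 2 ≤ 9) :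
    -1 ≤ -(r ^ 4 + 18 * r ^ 2 - 27) / (8 * r ^ 3) ∧
      -(r ^ 4 + 18 * r ^ 2 - 27) / (8 * r ^ 3) ≤ 1 := by
  have h : (r ^ 4 + 18 * r ^ 2 - 27) ^ 2 ≤ (8 * r ^ 3) ^ 2 := by
    have : (8 * r ^ 3) ^ 2 - (r ^ 4 + 18 * r ^ 2 - 27) ^ 2 = (9 - r ^ 2) ^ 3 * (r ^ 2 - 1) := by
      ring
    have h2 : 0 ≤ (9 - r ^ 2) ^ 3 * (r ^ 2 - 1) :=
      mul_nonneg (pow_nonneg (by linarith) 3) (by linarith)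
    linarith
  have hpos : 0 < 8 * r ^ 3 := by positivity
  obtain ⟨ha, hb⟩ := abs_le_of_sq_le_sq' h hpos.le
  rw [le_div_iff₀ hpos, div_le_iff₀ hpos]
  constructor <;> linarith

theorem theorem4p7 :
    ∃ (J₁ J₂ : ℝ → SU21) (Y : ℝ → ℝ),
      ContinuousOn (fun X => toMat (J₁ X)) pinchInterval ∧
      ContinuousOn (fun X => toMat (J₂ X)) pinchInterval ∧
      ContinuousOn Y pinchInterval ∧
      (∀ X ∈ pinchInterval,
        (IsEllipticSU (J₁ X) ∧ orderOf (J₁ X) = 3 ∧ orderOf (toPU (J₁ X)) = 3) ∧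
        (IsEllipticSU (J₂ X) ∧ orderOf (J₂ X) = 3 ∧ orderOf (toPU (J₂ X)) = 3) ∧
        IsParabolicSU (J₁ X * J₂ X) ∧
        IsParabolicSU (J₁ X * (J₂ X)⁻¹) ∧
        IsParabolicSU (J₁ X * J₂ X * (J₁ X)⁻¹ * (J₂ X)⁻¹) ∧
        pinchPoly X (Y X) = 0 ∧
        ‖(toMat (J₁ X * (J₂ X)⁻¹)).trace‖ ^ 2 = X ∧
        (toMat (J₁ X * J₂ X * (J₁ X)⁻¹ * (J₂ X)⁻¹)).trace =
          (((2 * X ^ 2 - 6 * X + 27 + Y X ^ 2 : ℝ) : ℂ)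
            + 2 * Complex.I * (X : ℂ) * (Y X : ℂ)) / (4 * (X : ℂ))) ∧
      (∀ X ∈ pinchInterval, ∀ X' ∈ pinchInterval, X ≠ X' →
        ¬ ∃ g : PU21, g * toPU (J₁ X) * g⁻¹ = toPU (J₁ X') ∧
          g * toPU (J₂ X) * g⁻¹ = toPU (J₂ X')) := by 
  have hex : ∀ X : ℝ, 2 * X ^ 2 - 18 * X + 27 ≤ 0 →
      ∃ t, 0 ≤ t ∧ t ≤ -(2 * X ^ 2 - 18 * X + 27) ∧ pinchQuartic X t = 0 :=
    fun X hX => exists_root_pinchQuartic hX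
  choose! T hT0 hTle hT using hex
  have hTc : ContinuousOn T pinchInterval :=
    continuousOn_root continuous_pinchQuartic pinchQuartic_strictMonoOn fun X hX =>
      ⟨hT0 X (quadratic_nonpos_of_mem hX), hT X (quadratic_nonpos_of_mem hX)⟩
  obtain ⟨Y, hY⟩ : ∃ Y : ℝ → ℝ, ∀ X, Y X = √(T X) := ⟨_, fun _ => rfl⟩
  obtain ⟨r, hr⟩ : ∃ r : ℝ → ℝ, ∀ X, r X = √((27 + T X) / (2 * X)) := ⟨_, fun _ => rfl⟩
  obtain ⟨κ, hκ⟩ : ∃ κ : ℝ → ℝ, ∀ X, κ X = Real.arccos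
    (-(r X ^ 4 + 18 * r X ^ 2 - 27) / (8 * r X ^ 3)) := ⟨_, fun _ => rfl⟩
  -- With `m = exp(iη/3)`, `|2m² + star (m²)²|² = 5 + 4 cos 2η = 1 + 8 cos² η`, and this must equal
  -- `X`.
  obtain ⟨η, hη⟩ : ∃ η : ℝ → ℝ, ∀ X, η X = Real.arccos √((X - 1) / 8) := ⟨_, fun _ => rfl⟩
  obtain ⟨k, hk⟩ : ∃ k : ℝ → ℂ, ∀ X, k X = Complex.exp ((κ X / 3 : ℝ) * Complex.I) :=
    ⟨_, fun _ => rfl⟩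
  obtain ⟨m, hm⟩ : ∃ m : ℝ → ℂ, ∀ X, m X = Complex.exp ((η X / 3 : ℝ) * Complex.I) :=
    ⟨_, fun _ => rfl⟩
  obtain ⟨a, ha⟩ : ∃ a : ℝ → ℝ, ∀ X, a X = √(-2 * (Real.cos (κ X) * Real.cos (η X)
    + Real.sin (κ X) * Real.sin (η X))) := ⟨_, fun _ => rfl⟩
  obtain ⟨u, hu⟩ : ∃ u : ℝ → ℂ, ∀ X, u X = ((-r X - 4 * Real.cos (κ X)) / 2 : ℝ)
    + (-Y X / (2 * r X) : ℝ) * Complex.I := ⟨_, fun _ => rfl⟩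
  obtain ⟨J₁, hJ₁⟩ : ∃ J : ℝ → SU21, ∀ X, J X = ofMat
    (cubicMat (k X * m X) (u X * star (m X) / a X)) := ⟨_, fun _ => rfl⟩
  obtain ⟨J₂, hJ₂⟩ : ∃ J : ℝ → SU21, ∀ X, J X = ofMat
    (cubicMat (k X * star (m X)) (a X)) := ⟨_, fun _ => rfl⟩
  have basic : ∀ X ∈ pinchInterval, 1 < X ∧ X < 9 ∧ 0 < r X ∧ 2 * X * r X ^ 2 = 27 + Y X ^ 2 ∧
      1 ≤ r X ^ 2 ∧ r X ^ 2 ≤ 9 ∧ pinchPoly X (Y X) = 0 := by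
    intro X hX
    have hq := quadratic_nonpos_of_mem hX
    have hY2 : Y X ^ 2 = T X := by rw [hY, Real.sq_sqrt (hT0 X hq)]
    have hX1 : 1 < X := by nlinarith
    have hpos : 0 < (27 + T X) / (2 * X) := div_pos (by linarith [hT0 X hq]) (by linarith)
    have hr2 : r X ^ 2 = (27 + T X) / (2 * X) := by rw [hr, Real.sq_sqrt hpos.le]
    have hZ : 2 * X * r X ^ 2 = 27 + T X := by rw [hr2]; field_simp
    obtain ⟨-, hX9, hZ1⟩ := trace_sq_bounds hq (hT0 X hq) hZ
    refine ⟨hX1, hX9, by rw [hr]; exact Real.sqrt_pos.2 hpos, by rw [hY2, hZ], by linarith, ?_, ?_⟩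
    · have := hTle X hq
      nlinarith
    · rw [pinchPoly_eq, hY2, hT X hq]
  have main : ∀ X ∈ pinchInterval, a X ≠ 0 ∧
      toMat (J₁ X) = cubicMat (k X * m X) (u X * star (m X) / a X) ∧
      toMat (J₂ X) = cubicMat (k X * star (m X)) (a X) ∧
      (IsEllipticSU (J₁ X) ∧ orderOf (J₁ X) = 3 ∧ orderOf (toPU (J₁ X)) = 3) ∧
      (IsEllipticSU (J₂ X) ∧ orderOf (J₂ X) = 3 ∧ orderOf (toPU (J₂ X)) = 3) ∧
      IsParabolicSU (J₁ X * J₂ X) ∧ IsParabolicSU (J₁ X * (J₂ X)⁻¹) ∧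
      IsParabolicSU (J₁ X * J₂ X * (J₁ X)⁻¹ * (J₂ X)⁻¹) ∧
      ‖(toMat (J₁ X * (J₂ X)⁻¹)).trace‖ ^ 2 = X ∧
      (toMat (J₁ X * J₂ X * (J₁ X)⁻¹ * (J₂ X)⁻¹)).trace =
        (((2 * X ^ 2 - 6 * X + 27 + Y X ^ 2 : ℝ) : ℂ)
          + 2 * Complex.I * (X : ℂ) * (Y X : ℂ)) / (4 * (X : ℂ)) := by
    intro X hX
    have hq := quadratic_nonpos_of_mem hX
    obtain ⟨hX1, hX9, hr0, hZ, hr1, hr9, hP⟩ := basic X hX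
    obtain ⟨hlo, hhi⟩ := abs_angle_bound hr0 hr1 hr9
    have hcosκ : Real.cos (κ X) = -(r X ^ 4 + 18 * r X ^ 2 - 27) / (8 * r X ^ 3) := by
      rw [hκ, Real.cos_arccos hlo hhi]
    have hC : 8 * r X ^ 3 * Real.cos (κ X) = -(r X ^ 4 + 18 * r X ^ 2 - 27) := by
      rw [hcosκ]; field_simp
    have hcosη : Real.cos (η X) = √((X - 1) / 8) := by
      rw [hη, Real.cos_arccos]
      · linarith [Real.sqrt_nonneg ((X - 1) / 8)]
      · exact Real.sqrt_le_iff.2 ⟨zero_le_one, by linarith⟩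
    have hD : 8 * Real.cos (η X) ^ 2 = X - 1 := by
      rw [hcosη, Real.sq_sqrt (by linarith)]; ring
    have hD0 : 0 < Real.cos (η X) := by
      rw [hcosη]; exact Real.sqrt_pos.2 (by linarith)
    have hS : 0 ≤ Real.sin (κ X) := by
      rw [hκ]; rw [Real.sin_arccos]; exact Real.sqrt_nonneg _
    have hE : 0 ≤ Real.sin (η X) := by
      rw [hη]; rw [Real.sin_arccos]; exact Real.sqrt_nonneg _
    refine ⟨?_, family_properties hq hr0 hZ hP hC hD (Real.cos_sq_add_sin_sq _)
      (Real.cos_sq_add_sin_sq _) hD0 hS hE (by rw [hk]; exact exp_mul_I_unit _)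
      (by rw [hm]; exact exp_mul_I_unit _) (by rw [hk]; exact exp_third_cube _)
      (by rw [hm]; exact exp_third_cube _) (ha X) (hu X) (hJ₁ X) (hJ₂ X)⟩
    rw [ha]
    refine (Real.sqrt_pos.2 ?_).ne'
    linarith [(mul_add_mul_neg hq hr0 hZ hP hC hD (Real.cos_sq_add_sin_sq _)
      (Real.cos_sq_add_sin_sq _) hD0 hS hE).2]
  have hYc : ContinuousOn Y pinchInterval := by
    rw [funext hY]; exact hTc.sqrt
  have hrc : ContinuousOn r pinchInterval := by
    rw [funext hr]
    refine ((continuousOn_const.add hTc).div (continuousOn_const.mul continuousOn_id) ?_).sqrt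
    intro X hX
    have := (basic X hX).1
    change 2 * X ≠ 0
    positivity
  have hr0 : ∀ X ∈ pinchInterval, r X ≠ 0 := fun X hX => (basic X hX).2.2.1.ne'
  have hκc : ContinuousOn κ pinchInterval := by
    rw [funext hκ]
    refine Real.continuous_arccos.comp_continuousOn (ContinuousOn.div (by fun_prop) (by fun_prop) ?_)
    intro X hX
    have := hr0 X hX
    positivity
  have hηc : Continuous η := by
    rw [funext hη]
    exact Real.continuous_arccos.comp (by fun_prop)
  have hkc : ContinuousOn k pinchInterval := by
    rw [funext hk]
    fun_prop
  have hmc : Continuous m := by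
    rw [funext hm]
    fun_prop
  have hac : ContinuousOn a pinchInterval := by
    rw [funext ha]
    fun_prop
  have huc : ContinuousOn u pinchInterval := by
    rw [funext hu]
    have h1 : ContinuousOn (fun X => -Y X / (2 * r X)) pinchInterval :=
      hYc.neg.div (continuousOn_const.mul hrc) fun X hX => by simpa using hr0 X hX
    fun_prop
  have hac' : ContinuousOn (fun X => (a X : ℂ)) pinchInterval := by fun_prop
  have hsm : ContinuousOn (fun X => star (m X)) pinchInterval := hmc.star.continuousOn
  refine ⟨J₁, J₂, Y, ?_, ?_, hYc, ?_, ?_⟩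
  -- `ofMat` is defined by choice, so continuity is read off the explicit matrices that `toMat`
  -- returns on the interval.
  · refine ContinuousOn.congr (continuous_cubicMat.comp_continuousOn
      ((hkc.mul hmc.continuousOn).prodMk ((huc.mul hsm).div hac' fun X hX => ?_)))
      fun X hX => (main X hX).2.1
    exact_mod_cast (main X hX).1
  · exact ContinuousOn.congr (continuous_cubicMat.comp_continuousOn ((hkc.mul hsm).prodMk hac'))
      fun X hX => (main X hX).2.2.1
  · intro X hX
    obtain ⟨-, -, -, e1, e2, p1, p2, p3, hn, hc⟩ := main X hX
    exact ⟨e1, e2, p1, p2, p3, (basic X hX).2.2.2.2.2.2, hn, hc⟩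
  · intro X hX X' hX' hne h
    apply hne
    have h1 := (main X hX).2.2.2.2.2.2.2.2.1
    have h2 := (main X' hX').2.2.2.2.2.2.2.2.1
    rw [← h1, ← h2, norm_trace_eq_of_conj h]
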